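/- Let $\Lambda$ be the Leech lattice with bilinear form $(\cdot,\cdot)$, let $\mathrm{Co}_0=O(\Lambda)$ be its group of isometries, and let $2^{12}{:}M_{24}\subseteq \mathrm{Co}_0$ be the monomial group, i.e. in standard coordinates the group of coordinate permutations in $M_{24}$ composed with the sign changes on the codewords of the binary Golay code. For a subgroup $G\subseteq\mathrm{Co}_0$ let $\Lambda^G=\{x\in\Lambda \mid gx=x \text{ for all } g\in G\}$, and let $\widetilde G$ be the pointwise stabilizer of $\Lambda^G$ in $\mathrm{Co}_0$. A sublattice $S\subseteq\Lambda$ is called an $\mathcal S$-lattice if every $u\in S$ can be written as $u=v+2w$ with $v\in\Lambda$, $(v,v)\le 6$ and $w\in S$. Let $G\subseteq\mathrm{Co}_0$ be a subgroup with $G=O^2(G)$, i.e. $G$ is generated by its elements of odd order. Then (at least) one of the following holds: (a) $\widetilde G$ is contained in a $\mathrm{Co}_0$-conjugate of $2^{12}{:}M_{24}$; (b) $\Lambda^G$ is an $\mathcal S$-lattice. -/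

import Mathlib

namespace Leech

/-- The 24-element projective line `{∞} ∪ 𝔽₂₃`, with `none` in the role of `∞`. It indexes the
coordinates. -/
abbrev Coord : Type := Option (ZMod 23)

/-- Generators of the Golay code: for `∞` the all-one word, and for `j ∈ 𝔽₂₃` the indicator word of
`{∞} ∪ {a | a + j is not a square in 𝔽₂₃}` (here `0` counts as a square). -/
def golayGenerator : Coord → Coord → ZMod 2
  | none, _ => 1
  | some _, none => 1
  | some j, some a => if IsSquare (a + j) then 0 else 1

/-- The extended binary Golay code, as the extended quadratic residue code of length 24. -/
def golay : Submodule (ZMod 2) (Coord → ZMod 2) :=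
  Submodule.span (ZMod 2) (Set.range golayGenerator)

/-- The Mathieu group `M₂₄`: the coordinate permutations that preserve the Golay code. -/
def M24 : Subgroup (Equiv.Perm Coord) where
  carrier := {σ | ∀ c : Coord → ZMod 2, c ∘ σ ∈ golay ↔ c ∈ golay}
  one_mem' := fun _ => Iff.rfl
  mul_mem' := by
    intro σ τ hσ hτ c
    rw [← hσ c, ← hτ (c ∘ σ)]
    rfl
  inv_mem' := by
    intro σ hσ c
    rw [← hσ (c ∘ ⇑σ⁻¹)]
    have h : (c ∘ ⇑σ⁻¹) ∘ ⇑σ = c := by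
      funext i
      simp
    rw [h]

theorem val_add_modEq (a b : ZMod 2) :
    (2 * ((a + b).val : ℤ)) ≡ 2 * (a.val : ℤ) + 2 * (b.val : ℤ) [ZMOD 4] := by
  revert a b
  decide

/-- The Leech lattice in the standard coordinates, scaled by `√8` so that the coordinates are
integers: all the coordinates have the same parity `m`, they are congruent modulo 4 to `m` off a
Golay codeword and to `m + 2` on it, and their sum is congruent to `4 m` modulo 8. -/
def lattice : AddSubgroup (Coord → ℤ) where
  carrier := {x | ∃ m : ℤ, ∃ c ∈ golay,
    (∀ i, x i ≡ m + 2 * ((c i).val : ℤ) [ZMOD 4]) ∧ ∑ i, x i ≡ 4 * m [ZMOD 8]}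
  zero_mem' := ⟨0, 0, golay.zero_mem, by simp, by simp⟩
  add_mem' := by
    rintro x y ⟨m, c, hc, h1, h2⟩ ⟨n, d, hd, h3, h4⟩
    refine ⟨m + n, c + d, golay.add_mem hc hd, fun i => ?_, ?_⟩
    · have h := val_add_modEq (c i) (d i)
      have h5 := h1 i
      have h6 := h3 i
      simp only [Pi.add_apply, Int.ModEq] at *
      omega
    · simp only [Pi.add_apply, Finset.sum_add_distrib, mul_add]
      exact h2.add h4
  neg_mem' := by
    rintro x ⟨m, c, hc, h1, h2⟩
    refine ⟨-m, c, hc, fun i => ?_, ?_⟩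
    · have h5 := h1 i
      simp only [Pi.neg_apply, Int.ModEq] at *
      omega
    · simp only [Pi.neg_apply, Finset.sum_neg_distrib, mul_neg]
      exact h2.neg

/-- The bilinear form of the Leech lattice. The factor `1/8` undoes the scaling of the coordinates,
so that the lattice is even and unimodular with minimal norm 4. -/
def form (x y : lattice) : ℚ :=
  ((∑ i, (x : Coord → ℤ) i * (y : Coord → ℤ) i : ℤ) : ℚ) / 8

/-- The Conway group `Co₀`: the automorphisms of the group `lattice` that preserve the form. -/
def Co0 : Subgroup (lattice ≃ₗ[ℤ] lattice) where
  carrier := {g | ∀ x y : lattice, form (g x) (g y) = form x y}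
  one_mem' := fun _ _ => rfl
  mul_mem' := by
    intro g h hg hh x y
    exact (hg (h x) (h y)).trans (hh x y)
  inv_mem' := by
    intro g hg x y
    rw [← hg (g⁻¹ x) (g⁻¹ y)]
    simp

/-- The sign attached to a binary digit. -/
def sign (a : ZMod 2) : ℤ := if a = 0 then 1 else -1

theorem sign_add (a b : ZMod 2) : sign (a + b) = sign a * sign b := by
  revert a b
  decide

theorem sign_mul_self (a : ZMod 2) : sign a * sign a = 1 := by
  revert a
  decide

/-- The standard monomial group `2¹²:M₂₄` in `Co₀`: the coordinate permutations in `M₂₄`, composed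
with the sign changes on a Golay codeword. -/
def monomial : Subgroup Co0 where
  carrier := {g | ∃ c ∈ golay, ∃ σ ∈ M24, ∀ (x : lattice) (i : Coord),
    ((g • x : lattice) : Coord → ℤ) i = sign (c i) * (x : Coord → ℤ) (σ i)}
  one_mem' := ⟨0, golay.zero_mem, 1, M24.one_mem, fun x i => by simp [sign]⟩
  mul_mem' := by
    rintro g h ⟨c, hc, σ, hσ, hg⟩ ⟨d, hd, τ, hτ, hh⟩
    refine ⟨c + d ∘ σ, golay.add_mem hc ((hσ d).2 hd), τ * σ, M24.mul_mem hτ hσ, fun x i => ?_⟩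
    rw [mul_smul, hg, hh, Pi.add_apply, sign_add, mul_assoc]
    rfl
  inv_mem' := by
    rintro g ⟨c, hc, σ, hσ, hg⟩
    refine ⟨c ∘ ⇑σ⁻¹, (M24.inv_mem hσ c).2 hc, σ⁻¹, M24.inv_mem hσ, fun x i => ?_⟩
    have h := hg (g⁻¹ • x) (σ⁻¹ i)
    have hi : σ (σ⁻¹ i) = i := by simp
    rw [smul_inv_smul, hi] at h
    rw [h, ← mul_assoc, Function.comp_apply, sign_mul_self, one_mul]

/-- `O²(G)` for a finite group `G`, given as a subgroup of `Γ`: the subgroup generated by the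
elements of `G` of odd order. -/
def O2 {Γ : Type*} [Group Γ] (G : Subgroup Γ) : Subgroup Γ :=
  Subgroup.closure {g | g ∈ G ∧ Odd (orderOf g)}

/-- The invariant lattice `Λ^G`. -/
def fixedLattice (G : Subgroup Co0) : AddSubgroup lattice :=
  FixedPoints.addSubgroup G lattice

/-- The pointwise stabilizer in `Co₀` of `Λ^G`. -/
def tilde (G : Subgroup Co0) : Subgroup Co0 :=
  fixingSubgroup Co0 (fixedLattice G : Set lattice)

/-- `S`-lattices: every `u ∈ S` is `v + 2 w` with `v` a vector of the Leech lattice of norm at most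
6 and `w ∈ S`. (A coset of `2Λ` that contains a vector `v` of norm at most 6 contains no vector of
norm at most 8 other than `v` and `-v`, so `v` is the short vector corresponding to `u`, up to a
sign that does not affect whether `w ∈ S`.) -/
def IsSLattice (S : AddSubgroup lattice) : Prop :=
  ∀ u ∈ S, ∃ v w : lattice, u = v + 2 • w ∧ form v v ≤ 6 ∧ w ∈ S

end Leech

/-!
Consider the classes of `Λ` modulo `2Λ`. Since `Λ` has no nonzero vector of norm less than 4, two
congruent vectors of norm at most 6 are equal or opposite (`eq_or_eq_neg_of_sqLen_le`), and two
congruent vectors of norm 8 are equal, opposite or orthogonal. If every `u ∈ Λ^G` is congruent to a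
vector `v` of norm at most 6, then each `g ∈ G` maps `v` to `v` or `-v`; elements of odd order fix
`v`, and they generate `G`, so `v ∈ Λ^G` and `Λ^G` is an `S`-lattice
(`isSLattice_of_forall_short`).

Otherwise some `u ∈ Λ^G` lies in another class, and the essential point `hasShortForm` is that
`Co₀` moves that class to the class of `8 e_∞`. The vectors of norm 8 in the latter are exactly the
`±8 eₐ` (`eq_frameVec_of_congr`), so the isometries that preserve this class permute these vectors
and are monomial (`mem_monomial_of_frame`). The group `G̃` fixes `u`, so a conjugate of `G̃` has
this property.

The reduction `hasShortForm` uses only the sign changes on codewords and the maps attached to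
sextets. For `x ∈ Λ` consider the set of coordinates that are 2 modulo 4, when `x` has even
coordinates; it is a codeword, which can be replaced by its complement. Odd vectors and dodecads
are mapped to the octad case (`HasShortForm.of_odd`, `HasShortForm.of_dodecad`). In the octad case
the class either contains a vector of norm 6 or can be mapped to one of a vector with coordinates
divisible by 4 (`HasShortForm.of_octad`), and among the latter only the classes of `(±4)⁴0²⁰` need
one more sextet map (`HasShortForm.of_tetrad`). Except for the step from dodecads to odd vectors,
the vector is first reduced modulo `2Λ` by means of coset leaders of the Golay code: every odd word
is congruent to a word of weight 1 or 3 (`exists_odd_leader`). This follows by counting from the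
dimension 12 and the minimal weight 8, which are read off from two complementary information sets.
-/

namespace Leech

/-! ### The Golay code -/

theorem card_coord : Fintype.card Coord = 24 := by simp [Fintype.card_option, ZMod.card]

/-- The position of a coordinate in the binary expansions below: the residue itself, and 23 for
`∞`. -/
def bitIndex : Coord → ℕ
  | none => 23
  | some a => a.val

/-- The word whose coordinates are the binary digits of `n`. -/
def ofBits (n : ℕ) : Coord → ZMod 2 := fun i => if n.testBit (bitIndex i) then 1 else 0

/-- For each position, the set of `j < 12`, as a bit mask, for which the generators of `j` add up
to the word of `systematic` at that position. -/
def coeffBits : List ℕ :=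
  [0xae3, 0x5dd, 0x242, 0xbc2, 0xf02, 0x781, 0x98f, 0x46b, 0x87a, 0x43d, 0x2b2, 0x159,
   0xf65, 0xdfd, 0x3d4, 0x1ea, 0xf90, 0x8ad, 0x17c, 0xbe, 0x5f, 0xa60, 0xa55, 0xa46]

/-- The words of `systematic`, as bit masks. Each of the two sets of positions below 12 and from 12
on is an information set of the code. -/
def systematicBits : List ℕ :=
  [0xc75001, 0x49f002, 0xd4b004, 0x6e3008, 0x9b3010, 0xb66020, 0xecc040, 0x1ed080,
   0x3da100, 0x7b4200, 0xb1d400, 0xe3a800, 0x00149f, 0x00293e, 0x0046e3, 0x008dc6,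
   0x010f13, 0x020ab9, 0x0401ed, 0x0803da, 0x1007b4, 0x200f68, 0x400a4f, 0x800c75]

/-- The codeword that is 1 at `i` and 0 at the other coordinates of the half that contains `i`,
where the halves are the positions below 12 and those from 12 on. -/
def systematic (i : Coord) : Coord → ZMod 2 := ofBits (systematicBits.getD (bitIndex i) 0)

/-- The Hamming weight. -/
def wt (c : Coord → ZMod 2) : ℕ := ∑ i, (c i).val

theorem golayGenerator_self_orthogonal (i j : Coord) :
    ∑ k, golayGenerator i k * golayGenerator j k = 0 := by
  revert i j
  decide +kernel

theorem four_dvd_wt_golayGenerator (i : Coord) : 4 ∣ wt (golayGenerator i) := by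
  revert i
  decide +kernel

theorem wt_systematic_add (i j : Coord) : wt (systematic i + systematic j) ≠ 4 := by
  revert i j
  decide +kernel

theorem wt_systematic (i : Coord) : wt (systematic i) = 8 := by
  revert i
  decide +kernel

theorem systematic_apply (i j : Coord)
    (h : bitIndex i < 12 ↔ bitIndex j < 12) : systematic i j = if i = j then 1 else 0 := by
  revert i j
  decide +kernel

theorem systematic_eq_sum (i : Coord) :
    systematic i = ∑ j : Fin 12,
      if (coeffBits.getD (bitIndex i) 0).testBit j then golayGenerator (some (j : ℕ)) else 0 := by
  revert i
  decide +kernel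

theorem zmod_two_eq (a : ZMod 2) : a = 0 ∨ a = 1 := by
  revert a
  decide

theorem wt_add (c d : Coord → ZMod 2) :
    wt (c + d) + 2 * ∑ i, (c i * d i).val = wt c + wt d := by
  simp only [wt, Finset.mul_sum, ← Finset.sum_add_distrib]
  refine Finset.sum_congr rfl fun i _ => ?_
  have h : ∀ a b : ZMod 2, (a + b).val + 2 * (a * b).val = a.val + b.val := by decide
  exact h _ _

theorem natCast_sum_val {ι : Type*} (s : Finset ι) (f : ι → ZMod 2) :
    ((∑ i ∈ s, (f i).val : ℕ) : ZMod 2) = ∑ i ∈ s, f i := by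
  rw [Nat.cast_sum]
  exact Finset.sum_congr rfl fun i _ => ZMod.natCast_zmod_val _

theorem two_dvd_sum_val_iff {ι : Type*} (s : Finset ι) (f : ι → ZMod 2) :
    2 ∣ ∑ i ∈ s, (f i).val ↔ ∑ i ∈ s, f i = 0 := by
  rw [← natCast_sum_val, ZMod.natCast_eq_zero_iff]

theorem wt_eq_zero {c : Coord → ZMod 2} : wt c = 0 ↔ c = 0 := by
  simp only [wt, Finset.sum_eq_zero_iff, Finset.mem_univ, true_imp_iff, ZMod.val_eq_zero,
    funext_iff, Pi.zero_apply]

theorem golay_orthogonal {c d : Coord → ZMod 2} (hc : c ∈ golay) (hd : d ∈ golay) :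
    ∑ i, c i * d i = 0 := by
  rw [golay] at hc hd
  induction hc, hd using Submodule.span_induction₂ with
  | mem_mem x y hx hy =>
    obtain ⟨i, rfl⟩ := hx
    obtain ⟨j, rfl⟩ := hy
    exact golayGenerator_self_orthogonal i j
  | zero_left y hy => simp
  | zero_right x hx => simp
  | add_left x y z _ _ _ h1 h2 => simp [add_mul, Finset.sum_add_distrib, h1, h2]
  | add_right x y z _ _ _ h1 h2 => simp [mul_add, Finset.sum_add_distrib, h1, h2]
  | smul_left r x y _ _ h => simp [mul_assoc, ← Finset.mul_sum, h]
  | smul_right r x y _ _ h => simp [mul_left_comm, ← Finset.mul_sum, h]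

theorem four_dvd_wt {c : Coord → ZMod 2} (hc : c ∈ golay) : 4 ∣ wt c := by
  have hc' := hc
  rw [golay] at hc
  induction hc using Submodule.span_induction with
  | mem x hx =>
    obtain ⟨i, rfl⟩ := hx
    exact four_dvd_wt_golayGenerator i
  | zero => simp [wt]
  | add x y hx hy h1 h2 =>
    have h := wt_add x y
    have h3 := (two_dvd_sum_val_iff Finset.univ (fun i => x i * y i)).2 (golay_orthogonal hx hy)
    have := h1 hx
    have := h2 hy
    omega
  | smul r x hx h =>
    rcases zmod_two_eq r with rfl | rfl
    · simp [wt]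
    · rw [one_smul]
      exact h hx

theorem systematic_mem_golay (i : Coord) : systematic i ∈ golay := by
  rw [systematic_eq_sum]
  refine Submodule.sum_mem _ fun j _ => ?_
  split_ifs
  · exact Submodule.subset_span ⟨_, rfl⟩
  · exact golay.zero_mem

/-- A word orthogonal to the code that vanishes on one of the two information sets is zero. -/
theorem eq_zero_of_orthogonal_of_vanish {z : Coord → ZMod 2} (p : Prop)
    (hz : ∀ c ∈ golay, ∑ i, z i * c i = 0) (h : ∀ i, (bitIndex i < 12 ↔ p) → z i = 0) :
    z = 0 := by
  funext i
  by_cases hi : bitIndex i < 12 ↔ p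
  · exact h i hi
  have h1 := hz _ (systematic_mem_golay i)
  rw [Finset.sum_eq_single i] at h1
  · rw [systematic_apply i i Iff.rfl] at h1
    simpa using h1
  · intro j _ hj
    by_cases hij : bitIndex i < 12 ↔ bitIndex j < 12
    · rw [systematic_apply i j hij, if_neg (Ne.symm hj), mul_zero]
    · rw [h j (by tauto), zero_mul]
  · simp

/-- A word orthogonal to the code is the combination of systematic codewords prescribed by its
values on one half. -/
theorem eq_sum_systematic {z : Coord → ZMod 2} (p : Prop)
    [DecidablePred fun i => bitIndex i < 12 ↔ p] (hz : ∀ c ∈ golay, ∑ i, z i * c i = 0) :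
    z = ∑ i with (bitIndex i < 12 ↔ p), z i • systematic i := by
  rw [← sub_eq_zero]
  refine eq_zero_of_orthogonal_of_vanish p (fun c hc => ?_) fun j hj => ?_
  · have h := golay_orthogonal (Submodule.sum_mem golay (t := Finset.univ.filter
      fun i => (bitIndex i < 12 ↔ p)) fun i _ =>
      golay.smul_mem (z i) (systematic_mem_golay i)) hc
    simp only [Pi.sub_apply, sub_mul, Finset.sum_sub_distrib, hz c hc, h, sub_zero]
  · rw [Pi.sub_apply, Finset.sum_apply, sub_eq_zero, Finset.sum_eq_single j]
    · simp [systematic_apply j j Iff.rfl]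
    · intro i hi hij
      rw [Pi.smul_apply, systematic_apply i j (by simp at hi; tauto), if_neg hij, smul_zero]
    · intro hj'
      simp [hj] at hj'

/-- The code contains its dual. -/
theorem mem_golay_of_orthogonal {z : Coord → ZMod 2}
    (hz : ∀ c ∈ golay, ∑ i, z i * c i = 0) : z ∈ golay := by
  rw [eq_sum_systematic True hz]
  exact Submodule.sum_mem _ fun i _ => golay.smul_mem _ (systematic_mem_golay i)

theorem one_mem_golay : (1 : Coord → ZMod 2) ∈ golay := Submodule.subset_span ⟨none, rfl⟩

/-- The indicator word of a set of coordinates. -/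
def word (S : Finset Coord) : Coord → ZMod 2 := fun i => if i ∈ S then 1 else 0

/-- The set of coordinates where a word is 1. -/
def supp (c : Coord → ZMod 2) : Finset Coord := Finset.univ.filter fun i => c i = 1

theorem mem_supp {c : Coord → ZMod 2} {i : Coord} : i ∈ supp c ↔ c i = 1 := by simp [supp]

theorem word_supp (c : Coord → ZMod 2) : word (supp c) = c := by
  funext i
  rcases zmod_two_eq (c i) with h | h <;> simp [word, mem_supp, h]

theorem sum_word_mul (S : Finset Coord) (c : Coord → ZMod 2) :
    ∑ i, word S i * c i = ∑ i ∈ S, c i := by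
  simp [word, Finset.sum_ite_mem]

theorem sum_val_eq_card (S : Finset Coord) (c : Coord → ZMod 2) :
    ∑ i ∈ S, (c i).val = (S ∩ supp c).card := by
  rw [← Finset.filter_mem_eq_inter, Finset.card_filter]
  refine Finset.sum_congr rfl fun i _ => ?_
  rcases zmod_two_eq (c i) with h | h <;> simp [mem_supp, h] <;> rfl

theorem wt_eq_card (c : Coord → ZMod 2) : wt c = (supp c).card := by
  rw [wt, sum_val_eq_card, Finset.univ_inter]

theorem supp_word (S : Finset Coord) : supp (word S) = S := by
  ext i
  simp [mem_supp, word]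

theorem wt_word (S : Finset Coord) : wt (word S) = S.card := by
  rw [wt_eq_card, supp_word]

/-- A codeword of weight 4 would be a sum of at most two systematic codewords of the same half. -/
theorem wt_ne_four {c : Coord → ZMod 2} (hc : c ∈ golay) : wt c ≠ 4 := by
  intro h4
  -- One of the two halves contains at most two of the four coordinates.
  have hsplit : ∃ p : Bool, ((supp c).filter fun i => (bitIndex i < 12 ↔ p = true)).card ≤ 2 := by
    by_contra! h
    have h1 := h true
    have h2 := h false
    simp only [iff_true, Bool.false_eq_true, iff_false] at h1 h2
    have h3 := Finset.card_filter_add_card_filter_not (s := supp c) (fun i => bitIndex i < 12)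
    rw [wt_eq_card] at h4
    omega
  obtain ⟨p, hp⟩ := hsplit
  have hsum := eq_sum_systematic (p = true) (fun d hd => golay_orthogonal hc hd)
  have hsum' : c = ∑ i ∈ (supp c).filter fun i => (bitIndex i < 12 ↔ p = true), systematic i := by
    refine hsum.trans ?_
    rw [Finset.sum_filter, Finset.sum_filter, supp, Finset.sum_filter]
    refine Finset.sum_congr rfl fun i _ => ?_
    rcases zmod_two_eq (c i) with h | h <;> simp [h]
  generalize (supp c).filter (fun i => (bitIndex i < 12 ↔ p = true)) = S at hp hsum'
  interval_cases h : S.card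
  · rw [Finset.card_eq_zero] at h
    subst h
    rw [hsum', Finset.sum_empty] at h4
    simp [wt] at h4
  · obtain ⟨i, rfl⟩ := Finset.card_eq_one.1 h
    rw [hsum', Finset.sum_singleton, wt_systematic] at h4
    omega
  · obtain ⟨i, j, hij, rfl⟩ := Finset.card_eq_two.1 h
    rw [hsum', Finset.sum_pair hij] at h4
    exact wt_systematic_add i j h4

theorem eq_zero_of_wt_lt {c : Coord → ZMod 2} (hc : c ∈ golay) (h : wt c < 8) : c = 0 := by
  have h1 := four_dvd_wt hc
  have h2 := wt_ne_four hc
  rw [← wt_eq_zero]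
  omega

theorem word_add_word (S T : Finset Coord) : word S + word T = word (symmDiff S T) := by
  funext i
  by_cases h1 : i ∈ S <;> by_cases h2 : i ∈ T <;>
    simp [word, Finset.mem_symmDiff, h1, h2]
  decide

theorem card_symmDiff_add (S T : Finset Coord) :
    (symmDiff S T).card + 2 * (S ∩ T).card = S.card + T.card := by
  have h := wt_add (word S) (word T)
  rw [word_add_word, wt_word, wt_word, wt_word] at h
  have h2 : ∀ i, word S i * word T i = word (S ∩ T) i := by
    intro i
    simp only [word, Finset.mem_inter, ite_and]
    split_ifs <;> rfl
  simp only [h2] at h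
  rw [← h, ← wt_word (S ∩ T), wt]

theorem add_self (c : Coord → ZMod 2) : c + c = 0 := by
  funext i
  exact CharTwo.add_self_eq_zero _

theorem eq_of_add_eq_zero {c d : Coord → ZMod 2} (h : c + d = 0) : c = d := by
  rw [← add_self d] at h
  exact add_right_cancel h

theorem word_injective : Function.Injective word := fun S T h => by
  rw [← supp_word S, h, supp_word]

/-- Sets that are congruent modulo the code and whose symmetric difference has fewer than eight
elements coincide, since the minimal weight is 8. -/
theorem eq_of_word_add_word_mem {S T : Finset Coord} (h : word S + word T ∈ golay)
    (hc : S.card + T.card < 8 + 2 * (S ∩ T).card) : S = T := by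
  apply word_injective
  apply eq_of_add_eq_zero
  apply eq_zero_of_wt_lt h
  rw [word_add_word, wt_word]
  have := card_symmDiff_add S T
  omega

open Classical in
theorem card_golay_ge : 4096 ≤ (Finset.univ.filter (· ∈ golay)).card := by
  let L := {i : Coord // bitIndex i < 12}
  have hL : Fintype.card L = 12 := by decide +kernel
  have hF : Fintype.card (L → ZMod 2) = 4096 := by
    rw [Fintype.card_fun, hL, ZMod.card]
    norm_num
  rw [← hF, ← Finset.card_univ]
  refine Finset.card_le_card_of_injOn (fun f => ∑ i, f i • systematic i.1) ?_ ?_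
  · intro f _
    simp only [Finset.coe_filter, Finset.mem_univ, true_and, Set.mem_ofPred_eq]
    exact Submodule.sum_mem _ fun i _ => golay.smul_mem _ (systematic_mem_golay _)
  · intro f _ g _ hfg
    have key : ∀ (f : L → ZMod 2) (j : L), (∑ i, f i • systematic i.1) j.1 = f j := by
      intro f j
      rw [Finset.sum_apply, Finset.sum_eq_single j]
      · simp [systematic_apply j.1 j.1 Iff.rfl]
      · intro i _ hij
        rw [Pi.smul_apply, systematic_apply _ _ (by simp [i.2, j.2]),
          if_neg fun h => hij (Subtype.ext h), smul_zero]
      · simp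
    funext j
    rw [← key f j, ← key g j]
    exact congrFun hfg j.1

theorem sum_word (S : Finset Coord) : ∑ i, word S i = (S.card : ZMod 2) := by
  have := sum_word_mul S 1
  simpa using this

theorem sum_golay {c : Coord → ZMod 2} (hc : c ∈ golay) : ∑ i, c i = 0 := by
  simpa using golay_orthogonal hc one_mem_golay

/-- Every word of odd weight is a codeword plus a word of weight 1 or 3: the code is perfect among
the words of odd weight. -/
theorem exists_odd_leader {z : Coord → ZMod 2} (hz : ∑ i, z i = 1) :
    ∃ S : Finset Coord, (S.card = 1 ∨ S.card = 3) ∧ z + word S ∈ golay := by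
  classical
  let A : Finset (Finset Coord) :=
    Finset.powersetCard 1 Finset.univ ∪ Finset.powersetCard 3 Finset.univ
  have hA : ∀ S, S ∈ A ↔ S.card = 1 ∨ S.card = 3 := by
    intro S
    simp [A, Finset.mem_powersetCard]
  have hAc : A.card = 2048 := by
    rw [Finset.card_union_of_disjoint, Finset.card_powersetCard, Finset.card_powersetCard]
    · rfl
    · rw [Finset.disjoint_left]
      intro S h1 h2
      rw [Finset.mem_powersetCard] at h1 h2
      omega
  let e : ZMod 2 → Coord → ZMod 2 := fun b => b • word {none}
  have he : ∀ b, ∑ i, e b i = b := by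
    intro b
    simp only [e, Pi.smul_apply, ← Finset.smul_sum, sum_word]
    simp
  -- The parity bit `b`, carried by `∞`, makes the count exact: `2¹² * 2¹¹ * 2 = 2²⁴`.
  let D := (Finset.univ.filter (· ∈ golay)) ×ˢ A ×ˢ (Finset.univ : Finset (ZMod 2))
  have hAodd : ∀ S ∈ A, ∑ i, word S i = 1 := by
    intro S hS
    rw [sum_word]
    rcases (hA S).1 hS with h | h <;> (rw [h]; rfl)
  have hsum : ∀ g S b, g ∈ golay → S ∈ A → ∑ i, (g + word S + e b) i = 1 + b := by
    intro g S b hg hS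
    simp only [Pi.add_apply, Finset.sum_add_distrib, he, hAodd S hS, sum_golay hg, zero_add]
  have hsurj := Finset.surjOn_of_injOn_of_card_le (s := D) (t := Finset.univ)
    (fun q : (Coord → ZMod 2) × Finset Coord × ZMod 2 => q.1 + word q.2.1 + e q.2.2)
    (fun _ _ => Finset.mem_coe.2 (Finset.mem_univ _)) ?_ ?_
  · obtain ⟨⟨g, S, b⟩, hq, h⟩ := hsurj (Finset.mem_coe.2 (Finset.mem_univ z))
    simp only [D, Finset.coe_product, Set.mem_prod, Finset.mem_coe, Finset.mem_filter,
      Finset.mem_univ, true_and, and_true] at hq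
    simp only at h
    have hb := hsum g S b hq.1 hq.2
    rw [h, hz] at hb
    have hb0 : b = 0 := by simpa using hb
    refine ⟨S, (hA S).1 hq.2, ?_⟩
    have : z + word S = g := by
      rw [← h, hb0]
      simp [e, add_assoc, add_self]
    rw [this]
    exact hq.1
  · rintro ⟨g, S, b⟩ hq ⟨g', S', b'⟩ hq' h
    simp only [D, Finset.coe_product, Set.mem_prod, Finset.mem_coe, Finset.mem_filter,
      Finset.mem_univ, true_and, and_true] at hq hq'
    simp only at h
    have hb := hsum g S b hq.1 hq.2
    rw [h, hsum g' S' b' hq'.1 hq'.2] at hb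
    obtain rfl : b = b' := (add_left_cancel hb).symm
    have h1 : g + word S = g' + word S' := add_right_cancel h
    have h2 : word S + word S' = g + g' := by
      have h3 : g + word S + (g + word S') = g' + word S' + (g + word S') := by rw [h1]
      calc word S + word S' = g + word S + (g + word S') := by
            rw [add_add_add_comm, add_self, zero_add]
        _ = g' + word S' + (g + word S') := h3
        _ = g + g' := by rw [add_add_add_comm, add_self, add_zero, add_comm]
    have h4 : S = S' := by
      refine eq_of_word_add_word_mem (h2 ▸ golay.add_mem hq.1 hq'.1) ?_
      have := (hA S).1 hq.2
      have := (hA S').1 hq'.2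
      omega
    subst h4
    rw [add_right_cancel h1]
  · rw [Finset.card_product, Finset.card_product, hAc, Finset.card_univ, Finset.card_univ,
      Fintype.card_fun, ZMod.card]
    have := card_golay_ge
    rw [card_coord]
    omega

theorem word_card_even {S : Finset Coord} {z : Coord → ZMod 2} (hz : ∑ i, z i = 0)
    (h : z + word S ∈ golay) : Even S.card := by
  have h1 := sum_golay h
  simp only [Pi.add_apply, Finset.sum_add_distrib, hz, zero_add, sum_word] at h1
  rwa [ZMod.natCast_eq_zero_iff_even] at h1

/-- Every word of even weight is a codeword plus a word of weight at most 4. -/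
theorem exists_even_leader {z : Coord → ZMod 2} (hz : ∑ i, z i = 0) :
    ∃ S : Finset Coord, S.card ≤ 4 ∧ Even S.card ∧ z + word S ∈ golay := by
  obtain ⟨S, hS, h⟩ := exists_odd_leader (z := z + word {none}) (by
    simp only [Pi.add_apply, Finset.sum_add_distrib, hz, sum_word]
    simp)
  have h2 : z + word (symmDiff {none} S) ∈ golay := by
    rwa [← word_add_word, ← add_assoc]
  refine ⟨_, ?_, word_card_even hz h2, h2⟩
  have := card_symmDiff_add {none} S
  rw [Finset.card_singleton] at this
  omega

/-- The Steiner property: every set of five coordinates lies in an octad. -/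
theorem exists_octad {S : Finset Coord} (hS : S.card = 5) :
    ∃ c ∈ golay, wt c = 8 ∧ S ⊆ supp c := by
  obtain ⟨R, hR, h⟩ := exists_odd_leader (z := word S) (by rw [sum_word, hS]; rfl)
  have h1 := card_symmDiff_add S R
  have h2 := four_dvd_wt h
  have h3 : wt (word S + word R) ≠ 0 := by
    intro h0
    rw [wt_eq_zero] at h0
    have := word_injective (eq_of_add_eq_zero h0)
    subst this
    omega
  have h4 := wt_ne_four h
  have h5 : wt (word S + word R) = (symmDiff S R).card := by rw [word_add_word, wt_word]
  refine ⟨_, h, by omega, ?_⟩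
  have h6 : (S ∩ R).card = 0 := by omega
  rw [Finset.card_eq_zero] at h6
  intro i hi
  rw [word_add_word, supp_word, Finset.mem_symmDiff]
  refine Or.inl ⟨hi, fun hi' => ?_⟩
  have := Finset.mem_inter.2 ⟨hi, hi'⟩
  simp [h6] at this

/-- A nonempty set of fewer than eight coordinates meets some codeword in an odd number of
coordinates, because the code is its own dual. -/
theorem exists_odd_inter {S : Finset Coord} (h0 : S.Nonempty) (h8 : S.card < 8) :
    ∃ c ∈ golay, ∑ i ∈ S, c i = 1 := by
  by_contra! h
  have h1 : word S ∈ golay := mem_golay_of_orthogonal fun c hc => by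
    rw [sum_word_mul]
    exact (zmod_two_eq _).resolve_right (h c hc)
  have h2 := eq_zero_of_wt_lt h1 (by rwa [wt_word])
  rw [← wt_eq_zero, wt_word, Finset.card_eq_zero] at h2
  exact h0.ne_empty h2

/-! ### Sextets -/

/-- A sextet: a partition of the coordinates into tetrads, any two of which add up to a codeword.
The partition is encoded by the function that sends a coordinate to its tetrad. -/
structure Sextet where
  block : Coord → Finset Coord
  card_block : ∀ i, (block i).card = 4
  mem_block : ∀ i k, k ∈ block i ↔ block k = block i
  add_mem : ∀ i k, word (block i) + word (block k) ∈ golay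

namespace Sextet

variable (B : Sextet)

/-- The six tetrads of a sextet. -/
def parts : Finset (Finset Coord) := Finset.univ.image B.block

theorem mem_parts {S : Finset Coord} : S ∈ B.parts ↔ ∃ i, B.block i = S := by
  simp [parts]

theorem self_mem (i : Coord) : i ∈ B.block i := (B.mem_block i i).2 rfl

theorem sum_parts {M : Type*} [AddCommMonoid M] (f : Coord → M) :
    ∑ S ∈ B.parts, ∑ i ∈ S, f i = ∑ i, f i := by
  rw [← Finset.sum_fiberwise_of_maps_to (s := Finset.univ) (t := B.parts) (g := B.block)
    fun i _ => B.mem_parts.2 ⟨i, rfl⟩]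
  refine Finset.sum_congr rfl fun S hS => ?_
  obtain ⟨k, rfl⟩ := B.mem_parts.1 hS
  congr 1
  ext i
  simp [B.mem_block]

theorem card_parts : B.parts.card = 6 := by
  have h := B.sum_parts (fun _ => 1)
  have h1 : ∑ S ∈ B.parts, ∑ i ∈ S, 1 = ∑ S ∈ B.parts, 4 := by
    refine Finset.sum_congr rfl fun S hS => ?_
    obtain ⟨k, rfl⟩ := B.mem_parts.1 hS
    rw [← Finset.card_eq_sum_ones, B.card_block]
  rw [h1, Finset.sum_const, ← Finset.card_eq_sum_ones, Finset.card_univ, card_coord] at h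
  simp only [smul_eq_mul] at h
  omega

theorem sum_block_eq {c : Coord → ZMod 2} (hc : c ∈ golay) (i k : Coord) :
    ∑ j ∈ B.block i, c j = ∑ j ∈ B.block k, c j := by
  have h := golay_orthogonal (B.add_mem i k) hc
  simp only [Pi.add_apply, add_mul, Finset.sum_add_distrib, sum_word_mul] at h
  exact CharTwo.add_eq_zero.1 h

/-- A word that is constant on the tetrads and takes the value 1 on an even number of them is a
codeword. -/
theorem comp_block_mem (f : Finset Coord → ZMod 2) (hf : ∑ S ∈ B.parts, f S = 0) :
    (fun i => f (B.block i)) ∈ golay := by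
  have h : (fun i => f (B.block i)) =
      ∑ S ∈ B.parts, f S • (word S + word (B.block none)) := by
    simp only [smul_add, Finset.sum_add_distrib, ← Finset.sum_smul, hf, zero_smul, add_zero]
    funext i
    rw [Finset.sum_apply, Finset.sum_eq_single (B.block i)]
    · simp [word, B.self_mem]
    · intro S hS hne
      obtain ⟨k, rfl⟩ := B.mem_parts.1 hS
      rw [Pi.smul_apply, word, if_neg fun h => hne ((B.mem_block k i).1 h).symm, smul_zero]
    · intro h
      exact absurd (B.mem_parts.2 ⟨i, rfl⟩) h
  rw [h]
  refine Submodule.sum_mem _ fun S hS => golay.smul_mem _ ?_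
  obtain ⟨k, rfl⟩ := B.mem_parts.1 hS
  exact B.add_mem k none

end Sextet

theorem symmDiff_sdiff_self_of_subset {C T : Finset Coord} (h : T ⊆ C) :
    symmDiff (C \ T) T = C := by
  ext j
  have := @h j
  simp only [Finset.mem_symmDiff, Finset.mem_sdiff]
  tauto

/-- Every tetrad belongs to a sextet. -/
theorem exists_sextet {T : Finset Coord} (hT : T.card = 4) :
    ∃ B : Sextet, ∀ i ∈ T, B.block i = T := by
  classical
  have h : ∀ i, ∃ R : Finset Coord, R.card = 4 ∧ i ∈ R ∧ word R + word T ∈ golay ∧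
      (i ∈ T → R = T) := by
    intro i
    by_cases hi : i ∈ T
    · exact ⟨T, hT, hi, by rw [add_self]; exact golay.zero_mem, fun _ => rfl⟩
    obtain ⟨c, hc, hw, hS⟩ := exists_octad (S := insert i T) (by
      rw [Finset.card_insert_of_notMem hi, hT])
    have hTc : T ⊆ supp c := fun j hj => hS (Finset.mem_insert_of_mem hj)
    refine ⟨supp c \ T, ?_, ?_, ?_, fun h => absurd h hi⟩
    · rw [Finset.card_sdiff_of_subset hTc, ← wt_eq_card, hw, hT]
    · exact Finset.mem_sdiff.2 ⟨hS (Finset.mem_insert_self i T), hi⟩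
    · rw [word_add_word, symmDiff_sdiff_self_of_subset hTc, word_supp]
      exact hc
  choose R hR4 hRi hRT hRe using h
  have hadd : ∀ i k, word (R i) + word (R k) ∈ golay := by
    intro i k
    have h := golay.add_mem (hRT i) (hRT k)
    rwa [add_add_add_comm, add_self, add_zero] at h
  refine ⟨⟨R, hR4, fun i k => ⟨fun hk => ?_, fun hk => hk ▸ hRi k⟩, hadd⟩, hRe⟩
  refine eq_of_word_add_word_mem (hadd k i) ?_
  have : 0 < (R k ∩ R i).card := Finset.card_pos.2 ⟨k, Finset.mem_inter.2 ⟨hRi k, hk⟩⟩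
  rw [hR4, hR4]
  omega

theorem exists_tetrad_supset {S : Finset Coord} (hS : S.card ≤ 4) :
    ∃ T, S ⊆ T ∧ T.card = 4 := by
  obtain ⟨T, hST, -, hT⟩ := Finset.exists_subsuperset_card_eq (Finset.subset_univ S)
    (n := 4) hS (by rw [Finset.card_univ, card_coord]; decide)
  exact ⟨T, hST, hT⟩

/-- Since an octad has eight coordinates and a sextet six tetrads, some tetrad of each sextet meets
the octad in at least two coordinates. -/
theorem exists_leader_octad {z c : Coord → ZMod 2} (hz : ∑ i, z i = 0) (hw : wt c = 8) :
    ∃ S : Finset Coord, S.card ≤ 4 ∧ Even S.card ∧ z + word S ∈ golay ∧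
      (S \ supp c).card ≤ 2 := by
  obtain ⟨S, hS4, hSe, hg⟩ := exists_even_leader hz
  by_cases h4 : S.card = 4
  · obtain ⟨B, hB⟩ := exists_sextet h4
    have hsum : ∑ P ∈ B.parts, (P ∩ supp c).card = 8 := by
      rw [← hw, wt, ← B.sum_parts]
      exact Finset.sum_congr rfl fun P _ => (sum_val_eq_card P c).symm
    obtain ⟨P, hP, hlt⟩ : ∃ P ∈ B.parts, 1 < (P ∩ supp c).card := by
      refine Finset.exists_lt_of_sum_lt ?_
      rw [hsum, Finset.sum_const, B.card_parts]
      decide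
    obtain ⟨k, rfl⟩ := B.mem_parts.1 hP
    obtain ⟨i, hi⟩ : S.Nonempty := Finset.card_pos.1 (by omega)
    have hmem : z + word (B.block k) ∈ golay := by
      have h := golay.add_mem hg (B.add_mem i k)
      rwa [hB i hi, add_assoc, ← add_assoc (word S), add_self, zero_add] at h
    refine ⟨B.block k, (B.card_block k).le, word_card_even hz hmem, hmem, ?_⟩
    have := Finset.card_sdiff_add_card_inter (B.block k) (supp c)
    rw [B.card_block] at this
    omega
  · refine ⟨S, hS4, hSe, hg, (Finset.card_le_card Finset.sdiff_subset).trans ?_⟩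
    obtain ⟨r, hr⟩ := hSe
    omega

/-- An octad that contains a tetrad of a sextet is the union of two of its tetrads. -/
theorem exists_octad_split {c : Coord → ZMod 2} (hc : c ∈ golay) (hw : wt c = 8)
    {T : Finset Coord} (hT : T ⊆ supp c) (hT4 : T.card = 4) (B : Sextet)
    (hB : ∀ i ∈ T, B.block i = T) :
    ∃ i k, c = word (B.block i) + word (B.block k) := by
  obtain ⟨i, hi⟩ : T.Nonempty := Finset.card_pos.1 (by omega)
  have hcard : (supp c \ T).card = 4 := by
    rw [Finset.card_sdiff_of_subset hT, ← wt_eq_card, hw, hT4]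
  obtain ⟨k, hk⟩ : (supp c \ T).Nonempty := Finset.card_pos.1 (by omega)
  have hsplit : word (supp c \ T) + word T = c := by
    rw [word_add_word, symmDiff_sdiff_self_of_subset hT, word_supp]
  refine ⟨i, k, ?_⟩
  have h : supp c \ T = B.block k := by
    refine eq_of_word_add_word_mem ?_ ?_
    · have h := golay.add_mem hc (B.add_mem i k)
      rwa [← hsplit, hB i hi, add_assoc, ← add_assoc (word T), add_self, zero_add] at h
    · have : 0 < ((supp c \ T) ∩ B.block k).card :=
        Finset.card_pos.2 ⟨k, Finset.mem_inter.2 ⟨hk, B.self_mem k⟩⟩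
      rw [hcard, B.card_block]
      omega
  rw [← h, hB i hi, add_comm, hsplit]

/-- Two coordinates off an octad lie in a common tetrad of a sextet that refines the octad. -/
theorem exists_sextet_octad {c : Coord → ZMod 2} (hc : c ∈ golay) (hw : wt c = 8)
    {R : Finset Coord} (hR : Disjoint R (supp c)) (hcard : R.card = 0 ∨ R.card = 2) :
    ∃ B : Sextet, (∃ i k, c = word (B.block i) + word (B.block k)) ∧
      ∀ j, Even (B.block j ∩ R).card := by
  have hw' : (supp c).card = 8 := by rw [← wt_eq_card, hw]
  rcases hcard with h | h
  · rw [Finset.card_eq_zero] at h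
    obtain ⟨T, hT, hT4⟩ := Finset.exists_subset_card_eq (s := supp c) (n := 4) (by omega)
    obtain ⟨B, hB⟩ := exists_sextet hT4
    refine ⟨B, exists_octad_split hc hw hT hT4 B hB, fun j => ?_⟩
    rw [h, Finset.inter_empty]
    exact Even.zero
  · obtain ⟨U, hU, hU3⟩ := Finset.exists_subset_card_eq (s := supp c) (n := 3) (by omega)
    have hRU : Disjoint R U := Finset.disjoint_of_subset_right hU hR
    obtain ⟨c', hc', hw2, hsub⟩ := exists_octad (S := R ∪ U) (by
      rw [Finset.card_union_of_disjoint hRU, h, hU3])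
    have hRc' : R ⊆ supp c' := Finset.subset_union_left.trans hsub
    have hUc' : U ⊆ supp c' := Finset.subset_union_right.trans hsub
    have hw2' : (supp c').card = 8 := by rw [← wt_eq_card, hw2]
    have hdj : Disjoint (supp c ∩ supp c') R :=
      (Finset.disjoint_of_subset_right Finset.inter_subset_left hR).symm
    have h4 : (supp c ∩ supp c').card = 4 := by
      have h1 := card_symmDiff_add (supp c) (supp c')
      have hmem := golay.add_mem hc hc'
      have h2 : wt (c + c') = (symmDiff (supp c) (supp c')).card := by
        rw [← wt_word, ← word_add_word, word_supp, word_supp]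
      have h3 := four_dvd_wt hmem
      have h5 := wt_ne_four hmem
      have h6 : 3 ≤ (supp c ∩ supp c').card := by
        rw [← hU3]
        exact Finset.card_le_card (Finset.subset_inter hU hUc')
      have h7 : (supp c ∩ supp c').card + 2 ≤ 8 := by
        rw [← h, ← Finset.card_union_of_disjoint hdj, ← hw2']
        exact Finset.card_le_card (Finset.union_subset Finset.inter_subset_right hRc')
      omega
    obtain ⟨B, hB⟩ := exists_sextet h4
    refine ⟨B, exists_octad_split hc hw Finset.inter_subset_left h4 B hB, fun j => ?_⟩
    obtain ⟨i, hi⟩ : (supp c ∩ supp c').Nonempty := Finset.card_pos.1 (by omega)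
    have hsplit := word_add_word (supp c' \ (supp c ∩ supp c')) (supp c ∩ supp c')
    rw [symmDiff_sdiff_self_of_subset Finset.inter_subset_right, word_supp] at hsplit
    -- The second tetrad of `c'` contains `R`.
    have hblock : ∀ p ∈ R, B.block p = supp c' \ (supp c ∩ supp c') := by
      intro p hp
      have hp' : p ∈ supp c' \ (supp c ∩ supp c') :=
        Finset.mem_sdiff.2 ⟨hRc' hp, fun h => Finset.disjoint_left.1 hdj h hp⟩
      refine eq_of_word_add_word_mem ?_ ?_
      · have h := golay.add_mem (B.add_mem p i) hc'
        rwa [← hsplit, hB i hi, add_comm (word (supp c' \ _)), add_assoc,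
          ← add_assoc (word (supp c ∩ supp c')), add_self, zero_add] at h
      · have : 0 < (B.block p ∩ (supp c' \ (supp c ∩ supp c'))).card :=
          Finset.card_pos.2 ⟨p, Finset.mem_inter.2 ⟨B.self_mem p, hp'⟩⟩
        rw [B.card_block, Finset.card_sdiff_of_subset Finset.inter_subset_right, hw2', h4]
        omega
    by_cases hj : ∃ p ∈ R, p ∈ B.block j
    · obtain ⟨p, hp, hpj⟩ := hj
      have hsub : R ⊆ B.block j := by
        intro q hq
        rw [← (B.mem_block j p).1 hpj, hblock p hp, ← hblock q hq]
        exact B.self_mem q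
      rw [Finset.inter_eq_right.2 hsub, h]
      exact even_two
    · have : B.block j ∩ R = ∅ := by
        rw [← Finset.disjoint_iff_inter_eq_empty, Finset.disjoint_left]
        exact fun p hp hp' => hj ⟨p, hp', hp⟩
      rw [this]
      exact Even.zero

/-! ### Vectors of the Leech lattice -/

theorem two_mul_val_modEq {a : ZMod 2} {n : ℤ} (h : (n : ZMod 2) = a) :
    2 * (a.val : ℤ) ≡ 2 * n [ZMOD 4] := by
  have h1 : ((a.val : ℤ) : ZMod 2) = n := by
    rw [h]
    simp
  have h2 := (ZMod.intCast_eq_intCast_iff _ _ 2).1 h1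
  have := h2.mul_left' (c := 2)
  exact_mod_cast this

/-- The defining congruences of the lattice, with the multiples of 4 made explicit. -/
theorem exists_coords (x : lattice) : ∃ m : ℤ, ∃ c ∈ golay, ∃ y : Coord → ℤ,
    (∀ i, (x : Coord → ℤ) i = m + 2 * ((c i).val : ℤ) + 4 * y i) ∧
      ∑ i, (x : Coord → ℤ) i ≡ 4 * m [ZMOD 8] := by
  obtain ⟨m, c, hc, h, hs⟩ := x.2
  refine ⟨m, c, hc, fun i => ((x : Coord → ℤ) i - (m + 2 * ((c i).val : ℤ))) / 4, fun i => ?_, hs⟩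
  have := h i
  simp only [Int.ModEq] at this ⊢
  omega

theorem sum_const_coord (m : ℤ) : ∑ _i : Coord, m = 24 * m := by
  rw [Finset.sum_const, Finset.card_univ, card_coord, nsmul_eq_mul]
  rfl

theorem sum_coords {x y : Coord → ℤ} {m : ℤ} {c : Coord → ZMod 2}
    (h : ∀ i, x i = m + 2 * ((c i).val : ℤ) + 4 * y i) :
    ∑ i, x i = 24 * m + 2 * wt c + 4 * ∑ i, y i := by
  rw [Finset.sum_congr rfl fun i _ => h i, Finset.sum_add_distrib, Finset.sum_add_distrib,
    sum_const_coord, ← Finset.mul_sum, ← Finset.mul_sum, wt, Nat.cast_sum]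

theorem val_add_one (a : ZMod 2) : ((a + 1).val : ℤ) = 1 - a.val := by
  revert a
  decide

/-- For a vector with even coordinates, the parameter `m` can be taken to be 0. -/
theorem exists_even_coords (x : lattice) (h : Even ((x : Coord → ℤ) none)) : ∃ c ∈ golay,
    ∃ y : Coord → ℤ, (∀ i, (x : Coord → ℤ) i = 2 * ((c i).val : ℤ) + 4 * y i) ∧
      ∑ i, (x : Coord → ℤ) i ≡ 0 [ZMOD 8] := by
  obtain ⟨m, c, hc, y, hy, hs⟩ := exists_coords x
  have hm : m % 2 = 0 := by
    have := hy none
    obtain ⟨r, hr⟩ := h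
    omega
  obtain ⟨n, rfl⟩ := Int.dvd_of_emod_eq_zero hm
  obtain ⟨q, rfl | rfl⟩ := Int.even_or_odd' n
  · refine ⟨c, hc, fun i => y i + q, fun i => ?_, ?_⟩
    · rw [hy]
      ring
    · simp only [Int.ModEq] at *
      omega
  · refine ⟨c + 1, golay.add_mem hc one_mem_golay, fun i => y i + q + (c i).val, fun i => ?_, ?_⟩
    · rw [hy, Pi.add_apply, Pi.one_apply, val_add_one]
      ring
    · simp only [Int.ModEq] at *
      omega

theorem sum_val_int (c : Coord → ZMod 2) : ∑ i, ((c i).val : ℤ) = wt c := by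
  rw [wt, Nat.cast_sum]

theorem intCast_sum_val {ι : Type*} (s : Finset ι) (f : ι → ZMod 2) :
    ((∑ i ∈ s, ((f i).val : ℤ) : ℤ) : ZMod 2) = ∑ i ∈ s, f i := by
  rw [← natCast_sum_val]
  push_cast
  rfl

theorem val_word (S : Finset Coord) (i : Coord) :
    ((word S i).val : ℤ) = if i ∈ S then 1 else 0 := by
  rw [word]
  split_ifs <;> rfl

/-- The coordinates of an integral vector, split into a codeword, a leader and an even part. -/
theorem exists_split (y : Coord → ℤ) (g : Coord → ZMod 2) (S : Finset Coord)
    (h : (fun i => (y i : ZMod 2)) + word S = g) :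
    ∃ w : Coord → ℤ, ∀ i, y i = ((g i).val : ℤ) + (if i ∈ S then 1 else 0) + 2 * w i := by
  have h1 : ∀ i, ∃ w, y i = ((g i).val : ℤ) + (if i ∈ S then 1 else 0) + 2 * w := by
    intro i
    have h2 : ((y i : ℤ) : ZMod 2) = (((g i).val + (word S i).val : ℤ) : ZMod 2) := by
      rw [← h]
      simp [add_assoc, CharTwo.add_self_eq_zero]
    have h3 := (ZMod.intCast_eq_intCast_iff _ _ 2).1 h2
    rw [val_word] at h3
    refine ⟨(y i - ((g i).val : ℤ) - (if i ∈ S then 1 else 0)) / 2, ?_⟩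
    simp only [Int.ModEq] at h3
    omega
  choose w hw using h1
  exact ⟨w, hw⟩

theorem even_of_sum {x : lattice} {y : Coord → ℤ} {c : Coord → ZMod 2} (hc : c ∈ golay)
    (hx : ∀ i, (x : Coord → ℤ) i = 2 * ((c i).val : ℤ) + 4 * y i) :
    ∑ i, (y i : ZMod 2) = 0 := by
  obtain ⟨-, -, -, -, hs⟩ := exists_even_coords x ⟨(c none).val + 2 * y none, by rw [hx]; ring⟩
  rw [sum_coords (x := x) (m := 0) (c := c) (y := y) (by simpa using hx)] at hs
  have h4 := four_dvd_wt hc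
  rw [← Int.cast_sum]
  refine ZMod.intCast_eq_zero_iff_even.2 (Int.even_iff.2 ?_)
  simp only [Int.ModEq] at hs
  omega

theorem odd_of_sum {x : lattice} {n : ℤ} {y : Coord → ℤ}
    (hx : ∀ i, (x : Coord → ℤ) i = 2 * n + 1 + 4 * y i) : ∑ i, (y i : ZMod 2) = 1 := by
  obtain ⟨m', c', hc', y', hy', hs⟩ := exists_coords x
  have h1 := hx none
  have h2 := hy' none
  have h3 : wt 0 = 0 := wt_eq_zero.2 rfl
  rw [sum_coords (x := x) (m := 2 * n + 1) (c := 0) (y := y) (by simpa using hx), h3] at hs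
  rw [← Int.cast_sum]
  refine ZMod.intCast_eq_one_iff_odd.2 (Int.odd_iff.2 ?_)
  simp only [Int.ModEq] at hs
  omega

/-- The squared length in the scaled coordinates. -/
def sqLen (x : Coord → ℤ) : ℤ := ∑ i, x i ^ 2

theorem form_self (x : lattice) : form x x = (sqLen x : ℚ) / 8 := by
  simp only [form, sqLen, pow_two]

/-- The Leech lattice has no nonzero vectors of norm less than 4. -/
theorem le_sqLen {x : lattice} (hx : x ≠ 0) : 32 ≤ sqLen x := by
  rcases Int.even_or_odd ((x : Coord → ℤ) none) with hev | hodd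
  · obtain ⟨c, hc, y, hy, hs⟩ := exists_even_coords x hev
    by_cases hc0 : c = 0
    · subst hc0
      have hy' : ∀ i, (x : Coord → ℤ) i = 4 * y i := by
        intro i
        rw [hy]
        simp
      have hsum : (∑ i, y i) % 2 = 0 := by
        simp only [hy', ← Finset.mul_sum, Int.ModEq] at hs
        omega
      have hpos : 0 < ∑ i, y i ^ 2 := by
        by_contra! h
        apply hx
        have h0 : ∑ i, y i ^ 2 = 0 := le_antisymm h (Finset.sum_nonneg fun i _ => sq_nonneg _)
        rw [Finset.sum_eq_zero_iff_of_nonneg fun i _ => sq_nonneg _] at h0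
        ext i
        rw [hy', pow_eq_zero_iff two_ne_zero |>.1 (h0 i (Finset.mem_univ i))]
        rfl
      have hpar : (∑ i, y i ^ 2) % 2 = 0 := by
        rw [← hsum]
        change _ ≡ _ [ZMOD 2]
        refine (Int.ModEq.sum fun i _ => ?_)
        rcases Int.emod_two_eq_zero_or_one (y i) with h | h <;>
          simp [Int.ModEq, pow_two, Int.mul_emod, h]
      have : sqLen x = 16 * ∑ i, y i ^ 2 := by
        rw [sqLen, Finset.mul_sum]
        refine Finset.sum_congr rfl fun i _ => ?_
        rw [hy']
        ring
      omega
    · have h8 : 8 ≤ wt c := by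
        by_contra! h
        exact hc0 (eq_zero_of_wt_lt hc h)
      have : ∑ i, 4 * ((c i).val : ℤ) ≤ sqLen x := by
        refine Finset.sum_le_sum fun i _ => ?_
        rw [hy]
        rcases zmod_two_eq (c i) with h | h
        · rw [h]
          simpa using sq_nonneg _
        · rw [h]
          have h1 : (((1 : ZMod 2).val : ℕ) : ℤ) = 1 := rfl
          rw [h1]
          nlinarith [mul_self_nonneg (2 * y i + 1), Int.le_self_sq (y i), Int.le_self_sq (- y i)]
      rw [← Finset.mul_sum, sum_val_int] at this
      omega
  · obtain ⟨m, c, hc, y, hy, hs⟩ := exists_coords x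
    have hm : m % 2 = 1 := by
      have := hy none
      obtain ⟨r, hr⟩ := hodd
      omega
    by_contra! hlt
    have hone : ∀ i, 1 ≤ (x : Coord → ℤ) i ^ 2 := by
      intro i
      have : (x : Coord → ℤ) i ≠ 0 := by
        have := hy i
        omega
      have := sq_pos_of_ne_zero this
      omega
    have hpm : ∀ i, (x : Coord → ℤ) i = 1 ∨ (x : Coord → ℤ) i = -1 := by
      intro i
      by_contra! h
      have h9 : 9 ≤ (x : Coord → ℤ) i ^ 2 := by
        have h1 : (x : Coord → ℤ) i ≤ -3 ∨ 3 ≤ (x : Coord → ℤ) i := by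
          have := hy i
          omega
        rcases h1 with h1 | h1 <;> nlinarith
      have h2 : ∑ j ∈ Finset.univ.erase i, (1 : ℤ) ≤ ∑ j ∈ Finset.univ.erase i,
          (x : Coord → ℤ) j ^ 2 := Finset.sum_le_sum fun j _ => hone j
      rw [Finset.sum_const, Finset.card_erase_of_mem (Finset.mem_univ i), Finset.card_univ,
        card_coord] at h2
      have h3 : (x : Coord → ℤ) i ^ 2 + ∑ j ∈ Finset.univ.erase i, (x : Coord → ℤ) j ^ 2 =
          sqLen x := Finset.add_sum_erase Finset.univ (fun j => (x : Coord → ℤ) j ^ 2)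
        (Finset.mem_univ i)
      have h4 : (24 - 1) • (1 : ℤ) = 23 := rfl
      rw [h4] at h2
      linarith
    have h4 := four_dvd_wt hc
    -- All coordinates are `±1`, with the minus signs on a codeword or off it.
    have hval : ∀ i, (c i).val < 2 := fun i => ZMod.val_lt _
    have h1 : ∃ e : ℤ, (e = 1 ∨ e = -1) ∧
        ∀ i, (x : Coord → ℤ) i = e * (1 - 2 * (c i).val) := by
      rcases (by omega : m % 4 = 1 ∨ m % 4 = 3) with h | h
      · refine ⟨1, Or.inl rfl, fun i => ?_⟩
        have := hpm i
        have := hy i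
        have := hval i
        omega
      · refine ⟨-1, Or.inr rfl, fun i => ?_⟩
        have := hpm i
        have := hy i
        have := hval i
        omega
    obtain ⟨e, he, hx'⟩ := h1
    rw [Finset.sum_congr rfl fun i _ => hx' i, ← Finset.mul_sum, Finset.sum_sub_distrib,
      ← Finset.mul_sum, sum_val_int, sum_const_coord, Int.ModEq] at hs
    rcases he with rfl | rfl <;> omega

theorem mem_lattice_four {w : Coord → ℤ} (hw : Even (∑ i, w i)) :
    (fun i => 4 * w i) ∈ lattice := by
  refine ⟨0, 0, golay.zero_mem, fun i => ?_, ?_⟩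
  · simp [Int.ModEq]
  · obtain ⟨r, hr⟩ := hw
    rw [← Finset.mul_sum, hr]
    simp only [Int.ModEq]
    omega

theorem mem_lattice_two {c : Coord → ZMod 2} (hc : c ∈ golay) :
    (fun i => 2 * ((c i).val : ℤ)) ∈ lattice := by
  refine ⟨0, c, hc, fun i => ?_, ?_⟩
  · simp [Int.ModEq]
  · rw [← Finset.mul_sum, sum_val_int]
    have := four_dvd_wt hc
    simp only [Int.ModEq]
    omega

theorem mem_lattice_odd : (fun i : Coord => if i = none then -3 else (1 : ℤ)) ∈ lattice := by
  refine ⟨1, 0, golay.zero_mem, fun i => ?_, ?_⟩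
  · change (if i = none then -3 else (1 : ℤ)) ≡ 1 + 2 * (((0 : ZMod 2).val : ℕ) : ℤ) [ZMOD 4]
    split_ifs <;> decide
  · decide +kernel

/-! ### Sign changes and sextet maps -/

theorem sign_eq (a : ZMod 2) : sign a = 1 - 2 * (a.val : ℤ) := by
  revert a
  decide

theorem sign_mul_mem {d : Coord → ZMod 2} (hd : d ∈ golay) (x : lattice) :
    (fun i => sign (d i) * (x : Coord → ℤ) i) ∈ lattice := by
  obtain ⟨m, c, hc, y, hy, hs⟩ := exists_coords x
  refine ⟨m, c + (m : ZMod 2) • d, golay.add_mem hc (golay.smul_mem _ hd), fun i => ?_, ?_⟩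
  · have h := two_mul_val_modEq (a := (c + (m : ZMod 2) • d) i) (n := (c i).val + m * (d i).val)
      (by simp)
    refine Int.ModEq.trans ?_ (h.symm.add_left m)
    change sign (d i) * (x : Coord → ℤ) i ≡ _ [ZMOD 4]
    rw [hy, sign_eq]
    rcases zmod_two_eq (d i) with h | h <;> rw [h]
    · simp [Int.ModEq]
    · have h1 : (((1 : ZMod 2).val : ℕ) : ℤ) = 1 := rfl
      simp only [h1, Int.ModEq]
      omega
  · have h1 : ∀ i, sign (d i) * (x : Coord → ℤ) i = (x : Coord → ℤ) i -
        (2 * m * (d i).val + 4 * ((c i * d i).val) + 8 * (y i * (d i).val)) := by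
      intro i
      have : (((c i * d i).val : ℕ) : ℤ) = (c i).val * (d i).val := by
        generalize c i = a
        generalize d i = b
        revert a b
        decide
      rw [sign_eq, this, hy]
      ring
    have h2 := (two_dvd_sum_val_iff Finset.univ fun i => c i * d i).2 (golay_orthogonal hc hd)
    have h3 := four_dvd_wt hd
    simp only [h1, Finset.sum_sub_distrib, Finset.sum_add_distrib, ← Finset.mul_sum,
      ← Nat.cast_sum]
    obtain ⟨q, hq⟩ := h2
    obtain ⟨r, hr⟩ := h3
    rw [wt] at hr
    rw [hq, hr]
    push_cast
    have h4 : 2 * m * (4 * (r : ℤ)) = 8 * (m * r) := by ring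
    rw [h4]
    simp only [Int.ModEq] at *
    omega

/-- The element of `Co₀` given by an additive involution that preserves the form. -/
def mkCo0 (f : lattice → lattice) (hadd : ∀ x y, f (x + y) = f x + f y)
    (hinv : ∀ x, f (f x) = x)
    (hform : ∀ x y : lattice, ∑ i, (f x : Coord → ℤ) i * (f y : Coord → ℤ) i =
      ∑ i, (x : Coord → ℤ) i * (y : Coord → ℤ) i) : Co0 :=
  ⟨AddEquiv.toIntLinearEquiv
    { toFun := f, invFun := f, left_inv := hinv, right_inv := hinv, map_add' := hadd }, by
    intro x y
    simp only [form]
    congr 2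
    exact hform x y⟩

/-- The sign change on a codeword, as an element of `Co₀`. -/
def signChange (d : Coord → ZMod 2) (hd : d ∈ golay) : Co0 :=
  mkCo0 (fun x => ⟨_, sign_mul_mem hd x⟩)
    (fun x y => by
      ext i
      simp [mul_add])
    (fun x => by
      ext i
      simp [← mul_assoc, sign_mul_self])
    (fun x y => by
      refine Finset.sum_congr rfl fun i _ => ?_
      linear_combination ((x : Coord → ℤ) i * (y : Coord → ℤ) i) * sign_mul_self (d i))

theorem signChange_apply {d : Coord → ZMod 2} (hd : d ∈ golay) (x : lattice) (i : Coord) :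
    ((signChange d hd • x : lattice) : Coord → ℤ) i = sign (d i) * (x : Coord → ℤ) i := rfl

namespace Sextet

variable (B : Sextet)

/-- The sign `-1` for the tetrad of `∞`, and `1` for the others. -/
def blockSign (S : Finset Coord) : ℤ := if S = B.block none then -1 else 1

theorem blockSign_eq (P : Finset Coord) :
    B.blockSign P = 1 ∨ B.blockSign P = -1 := by
  rw [blockSign]
  split_ifs <;> simp

theorem blockSign_mul_self (S : Finset Coord) : B.blockSign S * B.blockSign S = 1 := by
  unfold blockSign
  split_ifs <;> rfl

/-- One half of the sum of the coordinates in `S`. The division is exact for a lattice vector and a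
tetrad. -/
def halfSum (S : Finset Coord) (x : Coord → ℤ) : ℤ := (∑ i ∈ S, x i) / 2

/-- The linear map `ξ` attached to a sextet: it subtracts from each coordinate one half of the sum
over its tetrad, and then changes all signs on one of the tetrads, here the one of `∞`. -/
def mapFun (x : Coord → ℤ) (i : Coord) : ℤ :=
  B.blockSign (B.block i) * (x i - halfSum (B.block i) x)

theorem sum_block_coords {x y : Coord → ℤ} {m : ℤ} {c : Coord → ZMod 2}
    (h : ∀ i, x i = m + 2 * ((c i).val : ℤ) + 4 * y i) (i : Coord) :
    ∑ k ∈ B.block i, x k = 4 * m + 2 * ∑ k ∈ B.block i, ((c k).val : ℤ) +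
      4 * ∑ k ∈ B.block i, y k := by
  simp only [h, Finset.sum_add_distrib, ← Finset.mul_sum, Finset.sum_const, B.card_block,
    nsmul_eq_mul]
  norm_num

theorem two_mul_halfSum (x : lattice) (i : Coord) :
    2 * halfSum (B.block i) x = ∑ k ∈ B.block i, (x : Coord → ℤ) k := by
  obtain ⟨m, c, hc, y, hy, hs⟩ := exists_coords x
  rw [halfSum, B.sum_block_coords hy]
  omega

theorem mapFun_of_mem {i k : Coord} (h : k ∈ B.block i) (x : Coord → ℤ) :
    B.mapFun x k = B.blockSign (B.block i) * (x k - halfSum (B.block i) x) := by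
  rw [mapFun, (B.mem_block i k).1 h]

theorem sum_block_mapFun (x : lattice) (i : Coord) :
    ∑ k ∈ B.block i, B.mapFun x k = B.blockSign (B.block i) * (-2 * halfSum (B.block i) x) := by
  rw [Finset.sum_congr rfl fun k hk => B.mapFun_of_mem hk x, ← Finset.mul_sum,
    Finset.sum_sub_distrib, ← B.two_mul_halfSum, Finset.sum_const, B.card_block, nsmul_eq_mul]
  push_cast
  ring

/-- The new parameters are `-m - p`, where `p` is the number of coordinates of the codeword `c` in
the tetrad of `∞`, and the sum of `c` with the tetrads on which `f` is odd. When `-m - p` is odd,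
the change of signs on the tetrad of `∞` is what makes the number of these tetrads even. -/
theorem mapFun_mem (x : lattice) : B.mapFun x ∈ lattice := by
  obtain ⟨m, c, hc, y, hy, hs⟩ := exists_coords x
  let N : Finset Coord → ℤ := fun S => ∑ k ∈ S, ((c k).val : ℤ)
  let Y : Finset Coord → ℤ := fun S => ∑ k ∈ S, y k
  let p := N (B.block none)
  have hNp : ∀ i, ∃ e, N (B.block i) = p + 2 * e := by
    intro i
    have h : ((N (B.block i) : ℤ) : ZMod 2) = (p : ℤ) := by
      simp only [N, p, intCast_sum_val]
      exact B.sum_block_eq hc i none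
    have := (ZMod.intCast_eq_intCast_iff _ _ 2).1 h
    refine ⟨(N (B.block i) - p) / 2, ?_⟩
    simp only [Int.ModEq] at this
    omega
  let e : Finset Coord → ℤ := fun S => (N S - p) / 2
  have he : ∀ i, N (B.block i) = p + 2 * e (B.block i) := by
    intro i
    obtain ⟨e', h⟩ := hNp i
    simp only [e]
    omega
  have hh : ∀ i, halfSum (B.block i) x = 2 * m + N (B.block i) + 2 * Y (B.block i) := by
    intro i
    have h1 := B.two_mul_halfSum x i
    rw [B.sum_block_coords hy] at h1
    simp only [N, Y]
    omega
  let f : Finset Coord → ℤ := fun S => e S + Y S + if S = B.block none then -m - p else 0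
  have h4 := four_dvd_wt hc
  obtain ⟨q, hq⟩ := h4
  have hf : Even (∑ S ∈ B.parts, f S) := by
    have h1 : ∑ S ∈ B.parts, N S = wt c := by
      rw [B.sum_parts, sum_val_int]
    have h2 : ∑ S ∈ B.parts, N S = ∑ S ∈ B.parts, (p + 2 * e S) := by
      refine Finset.sum_congr rfl fun S hS => ?_
      obtain ⟨k, rfl⟩ := B.mem_parts.1 hS
      exact he k
    rw [Finset.sum_add_distrib, ← Finset.mul_sum, Finset.sum_const, B.card_parts, h1, hq] at h2
    have h3 : ∑ S ∈ B.parts, f S = ∑ S ∈ B.parts, e S + ∑ i, y i + (-m - p) := by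
      simp only [f, Finset.sum_add_distrib, Finset.sum_ite_eq']
      rw [if_pos (B.mem_parts.2 ⟨none, rfl⟩)]
      simp only [Y]
      rw [B.sum_parts]
    rw [sum_coords hy, hq] at hs
    rw [h3, Int.even_iff]
    simp only [Int.ModEq, nsmul_eq_mul] at hs h2
    push_cast at hs h2
    omega
  refine ⟨-m - p, c + fun i => ((f (B.block i) : ℤ) : ZMod 2), golay.add_mem hc
    (B.comp_block_mem (fun S => (f S : ZMod 2)) ?_), fun i => ?_, ?_⟩
  · rw [← Int.cast_sum]
    exact (ZMod.intCast_eq_zero_iff_even).2 hf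
  · have h := two_mul_val_modEq (a := (c + fun i => ((f (B.block i) : ℤ) : ZMod 2)) i)
      (n := (c i).val + f (B.block i)) (by simp)
    refine Int.ModEq.trans ?_ (h.symm.add_left _)
    rw [mapFun, hh, hy, he]
    simp only [f, blockSign, Int.ModEq]
    split_ifs <;> omega
  · have h1 : ∑ i, B.mapFun x i = -∑ i, (x : Coord → ℤ) i + 4 * halfSum (B.block none) x := by
      rw [← B.sum_parts, ← B.sum_parts (x : Coord → ℤ), ← Finset.sum_neg_distrib]
      have h2 : ∀ S ∈ B.parts, ∑ i ∈ S, B.mapFun x i = -∑ i ∈ S, (x : Coord → ℤ) i +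
          if S = B.block none then 4 * halfSum (B.block none) x else 0 := by
        intro S hS
        obtain ⟨k, rfl⟩ := B.mem_parts.1 hS
        rw [B.sum_block_mapFun, ← B.two_mul_halfSum, blockSign]
        split_ifs with h
        · rw [h]
          ring
        · ring
      rw [Finset.sum_congr rfl h2, Finset.sum_add_distrib, Finset.sum_ite_eq',
        if_pos (B.mem_parts.2 ⟨none, rfl⟩)]
    rw [h1, hh, he]
    have h6 : e (B.block none) = 0 := by
      simp [e, p]
    rw [h6]
    simp only [Int.ModEq] at *
    omega

theorem halfSum_add (x y : lattice) (i : Coord) : halfSum (B.block i) (x + y : lattice) =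
    halfSum (B.block i) x + halfSum (B.block i) y := by
  have h1 := B.two_mul_halfSum x i
  have h2 := B.two_mul_halfSum y i
  have h3 := B.two_mul_halfSum (x + y) i
  simp only [AddSubgroup.coe_add, Pi.add_apply, Finset.sum_add_distrib] at h3
  simp only [AddSubgroup.coe_add]
  omega

/-- The sextet map as an element of `Co₀`. -/
def toCo0 : Co0 :=
  mkCo0 (fun x => ⟨_, B.mapFun_mem x⟩)
    (fun x y => by
      ext i
      have := B.halfSum_add x y i
      simp only [AddSubgroup.coe_add] at this
      simp only [mapFun, AddSubgroup.coe_add, Pi.add_apply, this]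
      ring)
    (fun x => by
      ext i
      have h := B.two_mul_halfSum ⟨_, B.mapFun_mem x⟩ i
      simp only [sum_block_mapFun] at h
      have h2 : halfSum (B.block i) (B.mapFun x) =
          B.blockSign (B.block i) * (-halfSum (B.block i) x) := by linarith
      simp only [mapFun] at h2 ⊢
      rw [h2]
      linear_combination (x : Coord → ℤ) i * B.blockSign_mul_self (B.block i))
    (fun x y => by
      simp only
      rw [← B.sum_parts, ← B.sum_parts fun i => (x : Coord → ℤ) i * (y : Coord → ℤ) i]
      refine Finset.sum_congr rfl fun S hS => ?_
      obtain ⟨k, rfl⟩ := B.mem_parts.1 hS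
      have h1 := B.two_mul_halfSum x k
      have h2 := B.two_mul_halfSum y k
      have h3 : ∀ i ∈ B.block k, B.mapFun x i * B.mapFun y i =
          (x : Coord → ℤ) i * (y : Coord → ℤ) i
            - halfSum (B.block k) x * (y : Coord → ℤ) i
            - halfSum (B.block k) y * (x : Coord → ℤ) i
            + halfSum (B.block k) x * halfSum (B.block k) y := by
        intro i hi
        rw [B.mapFun_of_mem hi, B.mapFun_of_mem hi]
        linear_combination (((x : Coord → ℤ) i - halfSum (B.block k) x) *
          ((y : Coord → ℤ) i - halfSum (B.block k) y)) * B.blockSign_mul_self (B.block k)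
      rw [Finset.sum_congr rfl h3]
      simp only [Finset.sum_add_distrib, Finset.sum_sub_distrib, ← Finset.mul_sum, ← h1, ← h2,
        Finset.sum_const, B.card_block, nsmul_eq_mul]
      push_cast
      ring)

theorem toCo0_apply (x : lattice) (i : Coord) :
    ((B.toCo0 • x : lattice) : Coord → ℤ) i =
      B.blockSign (B.block i) * ((x : Coord → ℤ) i - halfSum (B.block i) x) := rfl

end Sextet

/-! ### Reduction modulo `2Λ` up to isometries -/

/-- Up to an isometry, `u` is congruent modulo `2Λ` to a vector of norm at most 6 or to the vector
with the single nonzero coordinate 8, at `∞`. -/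
def HasShortForm (u : lattice) : Prop :=
  ∃ k : Co0, ∃ v w : lattice, k • u = v + 2 • w ∧
    (sqLen v ≤ 48 ∨ ∀ i, (v : Coord → ℤ) i = if i = none then 8 else 0)

namespace HasShortForm

theorem of_smul {u : lattice} (k : Co0) (h : HasShortForm (k • u)) : HasShortForm u := by
  obtain ⟨k', v, w, h, hv⟩ := h
  exact ⟨k' * k, v, w, by rw [mul_smul, h], hv⟩

theorem of_sub {u w : lattice} (h : HasShortForm (u - 2 • w)) : HasShortForm u := by
  obtain ⟨k, v, w', h, hv⟩ := h
  refine ⟨k, v, w' + k • w, ?_, hv⟩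
  rw [two_nsmul, smul_sub, smul_add] at h
  rw [sub_eq_iff_eq_add.1 h]
  abel

theorem of_sqLen_le {u : lattice} (h : sqLen u ≤ 48) : HasShortForm u :=
  ⟨1, u, 0, by simp, Or.inl h⟩

theorem exists_sub_eight (x : lattice) {w : Coord → ℤ} (hw : Even (∑ i, w i)) :
    ∃ x' : lattice, (∀ i, (x' : Coord → ℤ) i = (x : Coord → ℤ) i - 8 * w i) ∧
      (HasShortForm x' → HasShortForm x) := by
  refine ⟨x - 2 • ⟨_, mem_lattice_four hw⟩, fun i => ?_, of_sub⟩
  simp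
  ring

theorem exists_sub_codeword (x : lattice) {g : Coord → ZMod 2} (hg : g ∈ golay) :
    ∃ x' : lattice, (∀ i, (x' : Coord → ℤ) i = (x : Coord → ℤ) i - 4 * ((g i).val : ℤ)) ∧
      (HasShortForm x' → HasShortForm x) := by
  refine ⟨x - 2 • ⟨_, mem_lattice_two hg⟩, fun i => ?_, of_sub⟩
  simp
  ring

/-- Modulo `2Λ` one may subtract any multiple of 8 from the coordinates, at the cost of subtracting
a further 8 at one chosen coordinate if the parity requires it. -/
theorem exists_reduce (x : lattice) (w : Coord → ℤ) (a : Coord) :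
    ∃ e : ℤ, (e = 0 ∨ e = 1) ∧ ∃ x' : lattice,
      (∀ i, (x' : Coord → ℤ) i = (x : Coord → ℤ) i - 8 * w i - if i = a then 8 * e else 0) ∧
      (HasShortForm x' → HasShortForm x) := by
  have key : ∀ e : ℤ, Even (∑ i, w i + e) → ∃ x' : lattice,
      (∀ i, (x' : Coord → ℤ) i = (x : Coord → ℤ) i - 8 * w i - if i = a then 8 * e else 0) ∧
      (HasShortForm x' → HasShortForm x) := by
    intro e he
    obtain ⟨x', hx', h⟩ := exists_sub_eight x (w := fun i => w i + if i = a then e else 0) (by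
      rw [Finset.sum_add_distrib, Finset.sum_ite_eq', if_pos (Finset.mem_univ a)]
      exact he)
    refine ⟨x', fun i => ?_, h⟩
    rw [hx']
    split_ifs <;> ring
  rcases Int.even_or_odd (∑ i, w i) with h | h
  · exact ⟨0, Or.inl rfl, key 0 (by simpa using h)⟩
  · exact ⟨1, Or.inr rfl, key 1 h.add_one⟩

theorem of_eight_dvd {x : lattice} (h : ∀ i, 8 ∣ (x : Coord → ℤ) i) : HasShortForm x := by
  choose w hw using h
  rcases Int.even_or_odd (∑ i, w i) with h | h
  · obtain ⟨x', hx', himp⟩ := exists_sub_eight x h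
    refine himp (of_sqLen_le ?_)
    simp [sqLen, hx', hw]
  · obtain ⟨x', hx', himp⟩ := exists_sub_eight x
      (w := fun i => w i - if i = none then 1 else 0) (by
        rw [Finset.sum_sub_distrib, Finset.sum_ite_eq', if_pos (Finset.mem_univ _)]
        exact h.sub_odd odd_one)
    refine himp ⟨1, x', 0, by simp, Or.inr fun i => ?_⟩
    rw [hx', hw]
    split_ifs <;> ring

/-- The sextet map of `S` makes all coordinates divisible by 8: in the typical case it sends a
vector `(±4)⁴0²⁰` with an odd number of minus signs to 8 times a signed coordinate vector. -/
theorem of_tetrad_odd {x : lattice} {S : Finset Coord} (hS : S.card = 4)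
    (h0 : ∀ i ∉ S, (x : Coord → ℤ) i = 0) (h4 : ∀ i ∈ S, (x : Coord → ℤ) i % 8 = 4)
    (hs : (∑ i ∈ S, (x : Coord → ℤ) i) % 16 = 8) : HasShortForm x := by
  obtain ⟨B, hB⟩ := exists_sextet hS
  refine of_smul B.toCo0 (of_eight_dvd fun i => ?_)
  rw [B.toCo0_apply]
  refine Dvd.dvd.mul_left ?_ _
  have h := B.two_mul_halfSum x i
  by_cases hi : i ∈ S
  · rw [hB i hi] at h ⊢
    have := h4 i hi
    omega
  · rw [Finset.sum_eq_zero] at h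
    · rw [h0 i hi]
      omega
    · intro k hk
      refine h0 k fun hk' => hi ?_
      rw [← hB k hk', (B.mem_block i k).1 hk]
      exact B.self_mem i

theorem of_tetrad {x : lattice} {S : Finset Coord} (hS : S.card = 4) {w : Coord → ℤ}
    (hx : ∀ i, (x : Coord → ℤ) i = 4 * (if i ∈ S then 1 else 0) + 8 * w i) : HasShortForm x := by
  obtain ⟨a, ha⟩ : S.Nonempty := Finset.card_pos.1 (by omega)
  obtain ⟨e, he, x', hx', himp⟩ := exists_reduce x w a
  refine himp ?_
  have hx1 : ∀ i, (x' : Coord → ℤ) i = (if i ∈ S then 4 else 0) - if i = a then 8 * e else 0 := by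
    intro i
    rw [hx', hx]
    split_ifs <;> ring
  rcases he with rfl | rfl
  · obtain ⟨d, hd, hdS⟩ := exists_odd_inter ⟨a, ha⟩ (by omega)
    refine of_smul (signChange d hd) (of_tetrad_odd hS ?_ ?_ ?_)
    · intro i hi
      rw [signChange_apply, hx1, if_neg hi]
      simp
    · intro i hi
      rw [signChange_apply, hx1, if_pos hi, sign_eq]
      have := ZMod.val_lt (d i)
      split_ifs <;> omega
    · have h1 : ∀ i ∈ S, ((signChange d hd • x' : lattice) : Coord → ℤ) i =
          4 - 8 * ((d i).val : ℤ) := by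
        intro i hi
        rw [signChange_apply, hx1, if_pos hi, sign_eq]
        split_ifs <;> ring
      rw [Finset.sum_congr rfl h1, Finset.sum_sub_distrib, ← Finset.mul_sum, Finset.sum_const, hS]
      have h2 : ¬ 2 ∣ ∑ i ∈ S, (d i).val := by
        rw [two_dvd_sum_val_iff, hdS]
        decide
      rw [← Nat.cast_sum]
      simp only [nsmul_eq_mul]
      omega
  · refine of_tetrad_odd hS ?_ ?_ ?_
    · intro i hi
      rw [hx1, if_neg hi, if_neg fun h : i = a => hi (h ▸ ha)]
      rfl
    · intro i hi
      rw [hx1, if_pos hi]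
      split_ifs <;> rfl
    · rw [Finset.sum_congr rfl fun i _ => hx1 i, Finset.sum_sub_distrib, Finset.sum_ite_eq',
        if_pos ha, Finset.sum_congr rfl fun i hi => if_pos hi, Finset.sum_const, hS]
      rfl

theorem of_four_dvd {x : lattice} (h : ∀ i, 4 ∣ (x : Coord → ℤ) i) : HasShortForm x := by
  choose y hy using h
  have hsum := even_of_sum golay.zero_mem (x := x) (y := y) (by simpa using hy)
  obtain ⟨S, hS4, hSe, hg⟩ := exists_even_leader hsum
  obtain ⟨w, hw⟩ := exists_split y _ S rfl
  obtain ⟨x', hx', himp⟩ := exists_sub_codeword x hg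
  refine himp ?_
  have hx1 : ∀ i, (x' : Coord → ℤ) i = 4 * (if i ∈ S then 1 else 0) + 8 * w i := by
    intro i
    rw [hx', hy, hw i]
    ring
  obtain h | h | h : S.card = 0 ∨ S.card = 2 ∨ S.card = 4 := by
    obtain ⟨r, hr⟩ := hSe
    omega
  · rw [Finset.card_eq_zero] at h
    refine of_eight_dvd fun i => ?_
    rw [hx1, h]
    simp
  · obtain ⟨a, ha⟩ : S.Nonempty := Finset.card_pos.1 (by omega)
    obtain ⟨e, he, x'', hx'', himp⟩ := exists_reduce x' w a
    refine himp (of_sqLen_le ?_)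
    have h1 : ∀ i, (x'' : Coord → ℤ) i ^ 2 = if i ∈ S then 16 else 0 := by
      intro i
      have hi : i = a → i ∈ S := fun h => h ▸ ha
      rw [hx'', hx1]
      rcases he with rfl | rfl <;> split_ifs <;> first | exact absurd (hi ‹_›) ‹_› | ring
    rw [sqLen, Finset.sum_congr rfl fun i _ => h1 i, Finset.sum_ite_mem, Finset.univ_inter,
      Finset.sum_const, h]
    decide
  · exact of_tetrad h hx1

/-- If `c` is a union of tetrads, and these are exactly the tetrads on which the sum of `y` is odd,
then the sextet map makes all coordinates divisible by 4. -/
theorem of_octad_sextet {x : lattice} {c : Coord → ZMod 2} {y : Coord → ℤ}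
    (hx : ∀ i, (x : Coord → ℤ) i = 2 * ((c i).val : ℤ) + 4 * y i) (B : Sextet)
    (hB : ∀ i, ∀ k ∈ B.block i, c k = c i)
    (hy : ∀ i, ∑ k ∈ B.block i, (y k : ZMod 2) = c i) : HasShortForm x := by
  refine of_smul B.toCo0 (of_four_dvd fun i => ?_)
  rw [B.toCo0_apply]
  refine Dvd.dvd.mul_left ?_ _
  have h := B.two_mul_halfSum x i
  rw [B.sum_block_coords (m := 0) (c := c) (y := y) (by simpa using hx),
    Finset.sum_congr rfl fun k hk => by rw [hB i k hk], Finset.sum_const, B.card_block] at h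
  have h2 := two_mul_val_modEq (a := c i) (n := ∑ k ∈ B.block i, y k) (by
    rw [Int.cast_sum]
    exact hy i)
  rw [hx]
  simp only [Int.ModEq, nsmul_eq_mul] at h h2
  push_cast at h
  omega

theorem of_octad {x : lattice} {c : Coord → ZMod 2} {y : Coord → ℤ} (hc : c ∈ golay)
    (hw : wt c = 8) (hx : ∀ i, (x : Coord → ℤ) i = 2 * ((c i).val : ℤ) + 4 * y i) :
    HasShortForm x := by
  have hsum := even_of_sum hc hx
  obtain ⟨S, hS4, hSe, hg, hS2⟩ := exists_leader_octad hsum hw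
  obtain ⟨w, hw'⟩ := exists_split y _ S rfl
  obtain ⟨x', hx', himp⟩ := exists_sub_codeword x hg
  refine himp ?_
  have hx1 : ∀ i, (x' : Coord → ℤ) i =
      2 * ((c i).val : ℤ) + 4 * ((if i ∈ S then 1 else 0) + 2 * w i) := by
    intro i
    rw [hx', hx, hw' i]
    ring
  have hcard := Finset.card_sdiff_add_card_inter S (supp c)
  have h012 : (S \ supp c).card = 1 ∨ ((S \ supp c).card = 0 ∨ (S \ supp c).card = 2) := by omega
  rcases h012 with h1 | h02
  · -- The class contains a vector of shape `(±2)⁸(±4)¹0¹⁵`.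
    obtain ⟨p, hp⟩ := Finset.card_pos.1 (by omega : 0 < (S \ supp c).card)
    obtain ⟨e, he, x'', hx'', himp⟩ := exists_reduce x'
      (fun i => w i + if i ∈ S ∩ supp c then 1 else 0) p
    refine himp (of_sqLen_le ?_)
    have h2 : ∀ i, (x'' : Coord → ℤ) i ^ 2 =
        4 * ((c i).val : ℤ) + if i ∈ S \ supp c then 16 else 0 := by
      intro i
      have hi : i = p → i ∈ S \ supp c := fun h => h ▸ hp
      rw [hx'', hx1]
      simp only [Finset.mem_inter, Finset.mem_sdiff, mem_supp] at hi ⊢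
      have hv : (((1 : ZMod 2).val : ℕ) : ℤ) = 1 := rfl
      have hv0 : (((0 : ZMod 2).val : ℕ) : ℤ) = 0 := rfl
      by_cases hip : i = p
      · have h : c i = 0 := (zmod_two_eq (c i)).resolve_right (hi hip).2
        simp only [eq_true hip, (hi hip).1, h, hv0]
        rcases he with rfl | rfl <;> simp <;> ring
      · simp only [eq_false hip]
        rcases zmod_two_eq (c i) with h | h <;> by_cases hS : i ∈ S <;>
          simp only [h, hS, hv, hv0] <;> simp <;> ring
    rw [sqLen, Finset.sum_congr rfl fun i _ => h2 i, Finset.sum_add_distrib, ← Finset.mul_sum,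
      sum_val_int, hw, Finset.sum_ite_mem, Finset.univ_inter, Finset.sum_const, h1]
    decide
  · obtain ⟨B, ⟨i₀, k₀, hik⟩, hB⟩ := exists_sextet_octad hc hw
      (R := S \ supp c) Finset.sdiff_disjoint h02
    have hconst : ∀ i, ∀ k ∈ B.block i, c k = c i := by
      intro i k hk
      rw [hik]
      simp only [Pi.add_apply, word, B.mem_block, (B.mem_block i k).1 hk]
    have hcase : ∀ i, c i = 1 → B.block i = B.block i₀ ∨ B.block i = B.block k₀ := by
      intro i hi
      by_contra! h
      rw [hik, Pi.add_apply, word, word, if_neg (by rw [B.mem_block]; exact h.1),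
        if_neg (by rw [B.mem_block]; exact h.2)] at hi
      exact absurd hi (by decide)
    have hne : B.block i₀ ≠ B.block k₀ := by
      intro h
      rw [h, add_self] at hik
      rw [hik] at hw
      simp [wt] at hw
    let y' : Coord → ℤ := fun i => (if i ∈ S then 1 else 0) + 2 * w i
    let F : Finset Coord → ZMod 2 := fun P => ∑ k ∈ P, (y' k : ZMod 2)
    have hy' : ∀ i, (y' i : ZMod 2) = word S i := by
      intro i
      simp only [y', word]
      push_cast
      rw [show (2 : ZMod 2) = 0 from rfl, zero_mul, add_zero]
    have hoff : ∀ i, c i = 0 → F (B.block i) = 0 := by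
      intro i hi
      have h1 : F (B.block i) = ((B.block i ∩ (S \ supp c)).card : ZMod 2) := by
        simp only [F, hy', ← sum_word, word, Finset.mem_inter, ite_and]
        rw [Finset.sum_ite_mem Finset.univ, Finset.univ_inter]
        refine Finset.sum_congr rfl fun k hk => ?_
        have : k ∉ supp c := by
          rw [mem_supp, hconst i k hk, hi]
          decide
        simp [this]
      rw [h1, ZMod.natCast_eq_zero_iff_even]
      exact hB i
    have hF : F (B.block i₀) = F (B.block k₀) := by
      have h1 : ∑ P ∈ B.parts, F P = F (B.block i₀) + F (B.block k₀) := by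
        refine Finset.sum_eq_add_of_mem _ _ (B.mem_parts.2 ⟨_, rfl⟩) (B.mem_parts.2 ⟨_, rfl⟩)
          hne fun P hP hPne => ?_
        obtain ⟨i, rfl⟩ := B.mem_parts.1 hP
        refine hoff i ((zmod_two_eq (c i)).resolve_right fun h => ?_)
        exact (hcase i h).elim hPne.1 hPne.2
      rw [B.sum_parts fun k => (y' k : ZMod 2), even_of_sum (x := x') (y := y') hc hx1] at h1
      exact CharTwo.add_eq_zero.1 h1.symm
    have hon : ∀ i, c i = 1 → F (B.block i) = F (B.block i₀) := by
      intro i hi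
      rcases hcase i hi with h | h <;> rw [h]
      exact hF.symm
    rcases zmod_two_eq (F (B.block i₀)) with h0 | h1
    · -- A sign change makes the tetrads of the octad odd.
      obtain ⟨d, hd, hdS⟩ := exists_odd_inter (S := B.block i₀) ⟨i₀, B.self_mem i₀⟩
        (by rw [B.card_block]; decide)
      refine of_smul (signChange d hd) (of_octad_sextet (c := c)
        (y := fun i => y' i - (d i).val * ((c i).val + 2 * y' i)) (fun i => ?_) B hconst
        fun i => ?_)
      · rw [signChange_apply, hx1, sign_eq]
        simp only [y']
        ring
      · have h2 : ∀ k ∈ B.block i, ((y' k - (d k).val * ((c k).val + 2 * y' k) : ℤ) : ZMod 2) =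
            (y' k : ZMod 2) - d k * c i := by
          intro k hk
          push_cast
          rw [show (2 : ZMod 2) = 0 from rfl, zero_mul, add_zero, ZMod.natCast_zmod_val,
            ZMod.natCast_zmod_val, hconst i k hk]
        rw [Finset.sum_congr rfl h2, Finset.sum_sub_distrib, ← Finset.sum_mul,
          B.sum_block_eq hd i i₀, hdS]
        change F (B.block i) - 1 * c i = c i
        rcases zmod_two_eq (c i) with h | h
        · rw [hoff i h, h]
          decide
        · rw [hon i h, h0, h]
          decide
    · refine of_octad_sextet (c := c) hx1 B hconst fun i => ?_
      change F (B.block i) = c i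
      rcases zmod_two_eq (c i) with h | h
      · rw [hoff i h, h]
      · rw [hon i h, h1, h]

/-- The coordinates modulo 4 after a sign change and a sextet map, for a vector that is congruent
modulo 8 to `m + 4` on `S` and to `m` off `S`. -/
theorem exists_coords_toCo0_signChange {x : lattice} {m : ℤ} {S : Finset Coord} {w : Coord → ℤ}
    (hx : ∀ i, (x : Coord → ℤ) i = m + 4 * (if i ∈ S then 1 else 0) + 8 * w i) (B : Sextet)
    {d : Coord → ZMod 2} (hd : d ∈ golay) {i k : Coord} (hk : k ∈ B.block i) :
    ∃ q, ((B.toCo0 • signChange d hd • x : lattice) : Coord → ℤ) k =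
      B.blockSign (B.block i) *
        (m * (∑ j ∈ B.block i, ((d j).val : ℤ) - 1 - 2 * ((d k).val : ℤ)) -
          2 * (B.block i ∩ S).card + 4 * q) := by
  let z : Coord → ℤ := fun j => w j - (d j).val * (if j ∈ S then 1 else 0) - 2 * (d j).val * w j
  have h1 : ∀ j, ((signChange d hd • x : lattice) : Coord → ℤ) j =
      m - 2 * m * ((d j).val : ℤ) + 4 * (if j ∈ S then 1 else 0) + 8 * z j := by
    intro j
    rw [signChange_apply, hx, sign_eq]
    ring
  have h2 := B.two_mul_halfSum (signChange d hd • x) i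
  rw [Finset.sum_congr rfl fun j _ => h1 j, Finset.sum_add_distrib, Finset.sum_add_distrib,
    Finset.sum_sub_distrib, ← Finset.mul_sum, ← Finset.mul_sum, ← Finset.mul_sum,
    Finset.sum_const, B.card_block, Finset.sum_ite_mem, Finset.sum_const, nsmul_eq_mul,
    nsmul_eq_mul] at h2
  push_cast at h2
  have h3 : Sextet.halfSum (B.block i) (signChange d hd • x : lattice) =
      2 * m - m * ∑ j ∈ B.block i, ((d j).val : ℤ) + 2 * (B.block i ∩ S).card +
        4 * ∑ j ∈ B.block i, z j := by
    linarith
  rw [B.toCo0_apply, (B.mem_block i k).1 hk, h1, h3]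
  refine ⟨(if k ∈ S then 1 else 0) + 2 * z k - ∑ j ∈ B.block i, z j, ?_⟩
  ring

/-- If a codeword meets every tetrad of a sextet oddly, then the corresponding sign change and the
sextet map turn a vector as below into one whose coordinates are 2 modulo 4 on a set that meets a
tetrad in one or three coordinates, according to the parity of its intersection with `S`. -/
theorem exists_coords_tetrad {x : lattice} {n : ℤ} {S : Finset Coord} {w : Coord → ℤ}
    (hx : ∀ i, (x : Coord → ℤ) i = 2 * n + 1 + 4 * (if i ∈ S then 1 else 0) + 8 * w i)
    (B : Sextet) {d : Coord → ZMod 2} (hd : d ∈ golay) (hdB : ∀ i, ∑ k ∈ B.block i, d k = 1) :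
    ∃ c ∈ golay, ∃ y : Coord → ℤ,
      (∀ i, ((B.toCo0 • signChange d hd • x : lattice) : Coord → ℤ) i =
        2 * ((c i).val : ℤ) + 4 * y i) ∧
      ∀ i, ∑ k ∈ B.block i, ((c k).val : ℤ) = if (B.block i ∩ S).card % 2 = 0 then 1 else 3 := by
  have hD : ∀ i, ∃ D : ℤ, (D = 1 ∨ D = 3) ∧ ∑ k ∈ B.block i, ((d k).val : ℤ) = D := by
    intro i
    have h1 : ¬ 2 ∣ ∑ k ∈ B.block i, (d k).val := by
      rw [two_dvd_sum_val_iff, hdB]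
      decide
    have h2 : ∑ k ∈ B.block i, (d k).val ≤ 4 := by
      rw [sum_val_eq_card, ← B.card_block i]
      exact Finset.card_le_card Finset.inter_subset_left
    refine ⟨_, ?_, rfl⟩
    rw [← Nat.cast_sum]
    omega
  have hev : Even (((B.toCo0 • signChange d hd • x : lattice) : Coord → ℤ) none) := by
    obtain ⟨q, hq⟩ := exists_coords_toCo0_signChange hx B hd (B.self_mem none)
    obtain ⟨D, h, hDs⟩ := hD none
    rw [hq, hDs]
    refine Even.mul_left (Int.even_iff.2 ?_) _
    rcases h with rfl | rfl <;> ring_nf <;> omega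
  obtain ⟨c, hc, y, hy, -⟩ := exists_even_coords _ hev
  refine ⟨c, hc, y, hy, fun i => ?_⟩
  obtain ⟨D, hD13, hDs⟩ := hD i
  have hck : ∀ k ∈ B.block i, ((c k).val : ℤ) =
      if ((B.block i ∩ S).card + (D - 1) / 2) % 2 = 0 then ((d k).val : ℤ) else 1 - (d k).val := by
    intro k hk
    obtain ⟨q, hq⟩ := exists_coords_toCo0_signChange hx B hd hk
    rw [hy, hDs] at hq
    have h1 := ZMod.val_lt (c k)
    have h2 : ((d k).val : ℤ) = 0 ∨ ((d k).val : ℤ) = 1 := by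
      have := ZMod.val_lt (d k)
      omega
    clear hx hy hDs hD hev hdB
    generalize ((d k).val : ℤ) = δ at *
    have h3 := B.blockSign_eq (B.block i)
    generalize B.blockSign (B.block i) = ε at *
    rcases h3 with rfl | rfl <;> rcases hD13 with rfl | rfl <;>
      rcases h2 with rfl | rfl <;> split_ifs <;> omega
  rw [Finset.sum_congr rfl hck]
  have h4 : ∑ k ∈ B.block i, (1 - ((d k).val : ℤ)) = 4 - D := by
    rw [Finset.sum_sub_distrib, Finset.sum_const, B.card_block, hDs]
    rfl
  by_cases h : ((B.block i ∩ S).card + (D - 1) / 2) % 2 = 0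
  · simp only [if_pos h, hDs]
    rcases hD13 with rfl | rfl <;> split_ifs <;> omega
  · simp only [if_neg h, h4]
    rcases hD13 with rfl | rfl <;> split_ifs <;> omega

/-- A vector with all coordinates congruent modulo 4 to an odd number: a sign change followed by a
sextet map turns it into a vector whose coordinates are congruent to 2 modulo 4 on an octad. -/
theorem of_modEq_odd {x : lattice} {m : ℤ} (hm : Odd m) {y : Coord → ℤ}
    (hx : ∀ i, (x : Coord → ℤ) i = m + 4 * y i) : HasShortForm x := by
  obtain ⟨n, rfl⟩ := hm
  obtain ⟨S, hS, hg⟩ := exists_odd_leader (odd_of_sum hx)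
  obtain ⟨w, hw⟩ := exists_split y _ S rfl
  obtain ⟨x', hx', himp⟩ := exists_sub_codeword x hg
  refine himp ?_
  have hx1 : ∀ i, (x' : Coord → ℤ) i =
      2 * n + 1 + 4 * (if i ∈ S then 1 else 0) + 8 * w i := by
    intro i
    rw [hx', hx, hw i]
    ring
  obtain ⟨T, hST, hT⟩ := exists_tetrad_supset (S := S) (by omega)
  obtain ⟨B, hB⟩ := exists_sextet hT
  obtain ⟨t, ht⟩ : T.Nonempty := Finset.card_pos.1 (by omega)
  obtain ⟨d, hd, hdT⟩ := exists_odd_inter (S := T) ⟨t, ht⟩ (by omega)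
  obtain ⟨c, hc, z, hz, hN⟩ := exists_coords_tetrad hx1 B hd fun i => by
    rw [B.sum_block_eq hd i t, hB t ht, hdT]
  refine of_smul (signChange d hd) (of_smul B.toCo0 (of_octad hc ?_ hz))
  have h8 : ∑ P ∈ B.parts, ∑ k ∈ P, ((c k).val : ℤ) =
      ∑ P ∈ B.parts, (1 + if P = T then 2 else 0) := by
    refine Finset.sum_congr rfl fun P hP => ?_
    obtain ⟨i, rfl⟩ := B.mem_parts.1 hP
    rw [hN]
    by_cases h : B.block i = T
    · rw [if_pos h, h, Finset.inter_eq_right.2 hST, if_neg (by omega)]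
      norm_num
    · have : B.block i ∩ S = ∅ := by
        rw [← Finset.disjoint_iff_inter_eq_empty, Finset.disjoint_left]
        intro k hk hkS
        rw [← (B.mem_block i k).1 hk, hB k (hST hkS)] at h
        exact h rfl
      rw [if_neg h, this, Finset.card_empty, if_pos rfl, add_zero]
  rw [B.sum_parts, sum_val_int, Finset.sum_add_distrib, Finset.sum_ite_eq',
    if_pos (B.mem_parts.2 ⟨t, hB t ht⟩), Finset.sum_const, B.card_parts, nsmul_eq_mul] at h8
  push_cast at h8
  omega

theorem of_odd {x : lattice} (h : Odd ((x : Coord → ℤ) none)) : HasShortForm x := by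
  obtain ⟨m, c, hc, y, hy, -⟩ := exists_coords x
  have hm : Odd m := by
    have := hy none
    rw [Int.odd_iff] at h ⊢
    omega
  obtain ⟨n, hn⟩ := hm
  refine of_smul (signChange c hc) (of_modEq_odd (m := m) ⟨n, hn⟩
    (y := fun i => y i - (c i).val * (n + 1 + 2 * y i)) fun i => ?_)
  have h1 : ((c i).val : ℤ) * (c i).val = (c i).val := by
    generalize c i = a
    revert a
    decide
  rw [signChange_apply, hy, sign_eq, hn]
  linear_combination (-4) * h1

/-- The sextet of a tetrad that meets the dodecad in three coordinates has all intersections odd,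
so its map produces odd coordinates. -/
theorem of_dodecad {x : lattice} {c : Coord → ZMod 2} {y : Coord → ℤ} (hc : c ∈ golay)
    (hw : wt c = 12) (hx : ∀ i, (x : Coord → ℤ) i = 2 * ((c i).val : ℤ) + 4 * y i) :
    HasShortForm x := by
  rw [wt_eq_card] at hw
  obtain ⟨U, hU, hU3⟩ := Finset.exists_subset_card_eq (s := supp c) (n := 3) (by omega)
  obtain ⟨p, hp⟩ : ∃ p, p ∉ supp c := by
    by_contra! h
    rw [Finset.eq_univ_iff_forall.2 h, Finset.card_univ, card_coord] at hw
    omega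
  have hpU : p ∉ U := fun h => hp (hU h)
  obtain ⟨B, hB⟩ := exists_sextet (T := insert p U) (by
    rw [Finset.card_insert_of_notMem hpU, hU3])
  refine of_smul B.toCo0 (of_odd ?_)
  have h1 : ∑ k ∈ B.block none, c k = 1 := by
    rw [B.sum_block_eq hc none p, hB p (Finset.mem_insert_self p U),
      Finset.sum_insert hpU, (zmod_two_eq (c p)).resolve_right fun h => hp (mem_supp.2 h),
      Finset.sum_congr rfl fun k hk => mem_supp.1 (hU hk), Finset.sum_const, hU3]
    rfl
  have h2 : ¬ 2 ∣ ∑ k ∈ B.block none, (c k).val := by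
    rw [two_dvd_sum_val_iff, h1]
    decide
  have h3 := B.two_mul_halfSum x none
  rw [B.sum_block_coords (m := 0) (c := c) (y := y) (by simpa using hx), ← Nat.cast_sum] at h3
  rw [B.toCo0_apply, Int.odd_mul]
  refine ⟨?_, ?_⟩
  · rw [Sextet.blockSign]
    split_ifs <;> decide
  · rw [hx, Int.odd_iff]
    omega

end HasShortForm

theorem wt_add_one (c : Coord → ZMod 2) : wt (c + 1) + wt c = 24 := by
  have h : ∀ a : ZMod 2, (a + 1).val + a.val = 1 := by decide
  rw [wt, wt, ← Finset.sum_add_distrib, Finset.sum_congr rfl fun i _ => show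
    ((c + 1) i).val + (c i).val = 1 from h (c i), ← Finset.card_eq_sum_ones, Finset.card_univ,
    card_coord]

/-- Every class modulo `2Λ` can be moved by `Co₀` to the class of a vector of norm at most 6 or to
the class of the standard frame. -/
theorem hasShortForm (x : lattice) : HasShortForm x := by
  rcases Int.even_or_odd ((x : Coord → ℤ) none) with hev | hodd
  swap
  · exact .of_odd hodd
  obtain ⟨c, hc, y, hy, -⟩ := exists_even_coords x hev
  -- Subtracting twice the vector `(-3, 1²³)` complements the codeword.
  have hcompl : ∃ y' : Coord → ℤ, ∀ i,
      ((x - 2 • ⟨_, mem_lattice_odd⟩ : lattice) : Coord → ℤ) i =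
        2 * (((c + 1) i).val : ℤ) + 4 * y' i := by
    refine ⟨fun i => y i + (c i).val - 1 + if i = none then 2 else 0, fun i => ?_⟩
    rw [Pi.add_apply, Pi.one_apply, val_add_one]
    simp only [AddSubgroup.coe_sub, Pi.sub_apply, hy, AddSubgroup.coe_nsmul, Pi.smul_apply]
    split_ifs <;> simp only [nsmul_eq_mul] <;> push_cast <;> ring
  obtain ⟨y', hy'⟩ := hcompl
  have hc1 := golay.add_mem hc one_mem_golay
  have h1 := wt_add_one c
  have h2 := four_dvd_wt hc
  have h3 := wt_ne_four hc
  have h4 := wt_ne_four hc1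
  obtain h | h | h | h | h : wt c = 0 ∨ wt c = 8 ∨ wt c = 12 ∨ wt (c + 1) = 8 ∨ wt (c + 1) = 0 := by
    omega
  · refine .of_four_dvd fun i => ⟨y i, ?_⟩
    rw [hy, wt_eq_zero.1 h]
    simp
  · exact .of_octad hc h hy
  · exact .of_dodecad hc h hy
  · exact .of_sub (.of_octad hc1 h hy')
  · refine .of_sub (w := ⟨_, mem_lattice_odd⟩) (.of_four_dvd fun i => ⟨y' i, ?_⟩)
    rw [hy', wt_eq_zero.1 h]
    simp

/-! ### Congruent short vectors -/

theorem two_nsmul_apply (w : lattice) (i : Coord) :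
    ((2 • w : lattice) : Coord → ℤ) i = 2 * (w : Coord → ℤ) i := by
  rw [two_nsmul, AddSubgroup.coe_add, Pi.add_apply, two_mul]

theorem sum_smul_mul_smul (k : Co0) (x y : lattice) :
    ∑ i, ((k • x : lattice) : Coord → ℤ) i * ((k • y : lattice) : Coord → ℤ) i =
      ∑ i, (x : Coord → ℤ) i * (y : Coord → ℤ) i := by
  have h : form (k • x) (k • y) = form x y := k.2 x y
  simp only [form] at h
  have h8 : (8 : ℚ) ≠ 0 := by norm_num
  exact_mod_cast (div_left_inj' h8).1 h

theorem sqLen_smul (k : Co0) (x : lattice) : sqLen (k • x : lattice) = sqLen x := by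
  simp only [sqLen, pow_two]
  exact sum_smul_mul_smul k x x

theorem sqLen_add_two_nsmul (v w : lattice) :
    4 * sqLen w + 4 * sqLen (v + w : lattice) =
      2 * (sqLen v + sqLen (v + 2 • w : lattice)) := by
  simp only [sqLen, Finset.mul_sum, ← Finset.sum_add_distrib]
  refine Finset.sum_congr rfl fun i _ => ?_
  simp only [AddSubgroup.coe_add, Pi.add_apply, two_nsmul_apply]
  ring

/-- Vectors of norm at most 6 that are congruent modulo `2Λ` are equal or opposite. -/
theorem eq_or_eq_neg_of_sqLen_le {v w : lattice} (hv : sqLen v ≤ 48)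
    (hw : sqLen (v + 2 • w : lattice) ≤ 48) : v + 2 • w = v ∨ v + 2 • w = -v := by
  by_cases h1 : w = 0
  · left
    simp [h1]
  by_cases h2 : v + w = 0
  · right
    rw [eq_neg_of_add_eq_zero_right h2]
    abel
  have := sqLen_add_two_nsmul v w
  have := le_sqLen h1
  have := le_sqLen h2
  omega

/-- The vector of norm 8 with the single nonzero coordinate 8, at `a`. -/
def frameVec (a : Coord) : lattice :=
  ⟨_, mem_lattice_four (w := fun i => if i = a then 2 else 0) (by simp)⟩

theorem frameVec_apply (a i : Coord) :
    (frameVec a : Coord → ℤ) i = if i = a then 8 else 0 := by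
  change 4 * (if i = a then 2 else 0) = _
  split_ifs <;> rfl

theorem sum_mul_frameVec (x : Coord → ℤ) (a : Coord) :
    ∑ i, x i * (frameVec a : Coord → ℤ) i = 8 * x a := by
  simp only [frameVec_apply, mul_ite, mul_zero, Finset.sum_ite_eq', Finset.mem_univ, if_true]
  ring

theorem sqLen_frameVec (a : Coord) : sqLen (frameVec a) = 64 := by
  have := sum_mul_frameVec (frameVec a) a
  rw [frameVec_apply] at this
  simpa [sqLen, pow_two] using this

theorem exists_frameVec_eq (a b : Coord) : ∃ w, frameVec a = frameVec b + 2 • w := by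
  refine ⟨⟨_, mem_lattice_four (w := fun i => (if i = a then 1 else 0) - if i = b then 1 else 0)
    (by simp [Finset.sum_sub_distrib])⟩, ?_⟩
  ext i
  simp only [AddSubgroup.coe_add, Pi.add_apply, two_nsmul_apply, frameVec_apply]
  split_ifs <;> rfl

/-- The vector `x - 8 eₐ = 2 w` has squared length at least `4 * 32` in the scaled coordinates. -/
theorem apply_nonpos_of_congr {x w : lattice} {a : Coord} (hx : sqLen x = 64)
    (h : x = frameVec a + 2 • w) (hne : w ≠ 0) : (x : Coord → ℤ) a ≤ 0 := by
  have h1 : 4 * sqLen w = sqLen x - 16 * (x : Coord → ℤ) a + 64 := by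
    have h2 := sum_mul_frameVec x a
    rw [← sqLen_frameVec a]
    have h3 : sqLen x - 16 * (x : Coord → ℤ) a + sqLen (frameVec a) =
        sqLen x - 2 * ∑ i, (x : Coord → ℤ) i * (frameVec a : Coord → ℤ) i +
          sqLen (frameVec a) := by
      rw [h2]
      ring
    rw [h3]
    simp only [sqLen, Finset.mul_sum, ← Finset.sum_add_distrib, ← Finset.sum_sub_distrib]
    refine Finset.sum_congr rfl fun i _ => ?_
    rw [h]
    simp only [AddSubgroup.coe_add, Pi.add_apply, two_nsmul_apply]
    ring
  have := le_sqLen hne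
  omega

/-- The vectors of norm 8 in the class of the frame vectors are, up to sign, the frame vectors. -/
theorem eq_frameVec_of_congr {x w : lattice} {b : Coord} (hx : sqLen x = 64)
    (h : x = frameVec b + 2 • w) : ∃ a, x = frameVec a ∨ x = -frameVec a := by
  by_contra! hne
  have h0 : ∀ a, (x : Coord → ℤ) a = 0 := by
    intro a
    obtain ⟨w', hw'⟩ := exists_frameVec_eq b a
    have h1 : x = frameVec a + 2 • (w' + w) := by
      rw [h, hw']
      abel
    have h2 : -x = frameVec a + 2 • (-frameVec a - (w' + w)) := by
      rw [h1]
      abel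
    have h3 := apply_nonpos_of_congr hx h1 fun h0 => (hne a).1 (by rw [h1, h0]; simp)
    have h4 := apply_nonpos_of_congr (x := -x) (by simpa [sqLen] using hx) h2 fun h0 =>
      (hne a).2 (by rw [← neg_eq_iff_eq_neg, h2, h0]; simp)
    simp only [AddSubgroup.coe_neg, Pi.neg_apply] at h4
    omega
  rw [sqLen, Finset.sum_eq_zero fun i _ => by rw [h0]; rfl] at hx
  omega

/-! ### The stabilizer of the standard frame -/

/-- Apply the isometry to the vector that is 2 on the codeword and 0 elsewhere. -/
theorem comp_mem_golay_of_signed_perm {k : Co0} {e : Coord → ℤ} {p : Coord → Coord}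
    (he : ∀ i, e i = 1 ∨ e i = -1)
    (hk : ∀ (x : lattice) i, ((k • x : lattice) : Coord → ℤ) i = e i * (x : Coord → ℤ) (p i))
    {c : Coord → ZMod 2} (hc : c ∈ golay) : c ∘ p ∈ golay := by
  have h := hk ⟨_, mem_lattice_two hc⟩
  simp only at h
  obtain ⟨c', hc', y, hy, -⟩ := exists_even_coords (k • ⟨_, mem_lattice_two hc⟩ : lattice) (by
    rw [h]
    exact (even_two_mul _).mul_left _)
  have : c ∘ p = c' := by
    funext i
    have h1 := hy i
    rw [h] at h1
    have h2 := ZMod.val_lt (c' i)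
    have h3 := ZMod.val_lt (c (p i))
    apply ZMod.val_injective
    rw [Function.comp_apply]
    rcases he i with h4 | h4 <;> rw [h4] at h1 <;> omega
  rw [this]
  exact hc'

/-- Apply the isometry to `(-3, 1²³)` and read its signs modulo 4. -/
theorem sign_mem_golay_of_signed_perm {k : Co0} {c : Coord → ZMod 2} {p : Coord → Coord}
    (hk : ∀ (x : lattice) i,
      ((k • x : lattice) : Coord → ℤ) i = sign (c i) * (x : Coord → ℤ) (p i)) : c ∈ golay := by
  have h := hk ⟨_, mem_lattice_odd⟩
  simp only at h
  obtain ⟨m, c', hc', y, hy, -⟩ := exists_coords (k • ⟨_, mem_lattice_odd⟩ : lattice)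
  have h1 : ∀ i, ∃ z, 1 - 2 * ((c i).val : ℤ) = m + 2 * ((c' i).val : ℤ) + 4 * z := by
    intro i
    have h1 := hy i
    rw [h, sign_eq] at h1
    split_ifs at h1
    · exact ⟨y i + 1 - 2 * (c i).val, by linarith⟩
    · exact ⟨y i, by linarith⟩
  have hm : m % 4 = 1 ∨ m % 4 = 3 := by
    obtain ⟨z, hz⟩ := h1 none
    omega
  rcases hm with hm | hm
  · have : c = c' := by
      funext i
      obtain ⟨z, hz⟩ := h1 i
      have h2 := ZMod.val_lt (c' i)
      have h3 := ZMod.val_lt (c i)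
      apply ZMod.val_injective
      omega
    rwa [this]
  · have : c = c' + 1 := by
      funext i
      obtain ⟨z, hz⟩ := h1 i
      have h2 := ZMod.val_lt (c' i)
      have h3 := ZMod.val_lt (c i)
      have h4 := val_add_one (c' i)
      apply ZMod.val_injective
      rw [Pi.add_apply, Pi.one_apply]
      omega
    rw [this]
    exact golay.add_mem hc' one_mem_golay

theorem mem_monomial_of_frame {k : Co0}
    (hk : ∀ a, ∃ b, k • frameVec a = frameVec b ∨ k • frameVec a = -frameVec b) :
    k ∈ monomial := by
  have hk' : ∀ a, ∃ b, ∃ e : ℤ, (e = 1 ∨ e = -1) ∧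
      ∀ i, ((k • frameVec a : lattice) : Coord → ℤ) i = e * (frameVec b : Coord → ℤ) i := by
    intro a
    obtain ⟨b, h | h⟩ := hk a
    · exact ⟨b, 1, Or.inl rfl, fun i => by rw [h, one_mul]⟩
    · exact ⟨b, -1, Or.inr rfl, fun i => by rw [h]; simp⟩
  choose τ e he hτ using hk'
  have hcoord : ∀ (x : lattice) a, ((k • x : lattice) : Coord → ℤ) (τ a) =
      e a * (x : Coord → ℤ) a := by
    intro x a
    have h := sum_smul_mul_smul k x (frameVec a)
    simp only [hτ, mul_left_comm _ (e a), ← Finset.mul_sum, sum_mul_frameVec] at h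
    rcases he a with h1 | h1 <;> rw [h1] at h ⊢ <;> linarith
  have hinj : Function.Injective τ := by
    intro a b hab
    have h := hcoord (frameVec b) b
    rw [← hab, hcoord, frameVec_apply, frameVec_apply, if_pos rfl] at h
    by_contra hne
    rw [if_neg hne] at h
    rcases he b with h1 | h1 <;> rw [h1] at h <;> omega
  let σ : Equiv.Perm Coord := (Equiv.ofBijective τ (Finite.injective_iff_bijective.1 hinj)).symm
  have hστ : ∀ a, σ (τ a) = a := fun a => Equiv.ofBijective_symm_apply_apply τ _ a
  have hτσ : ∀ i, τ (σ i) = i := fun i => Equiv.ofBijective_apply_symm_apply τ _ i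
  let c : Coord → ZMod 2 := fun i => if e (σ i) = 1 then 0 else 1
  have hc : ∀ i, sign (c i) = e (σ i) := by
    intro i
    rcases he (σ i) with h | h <;> simp [c, h, sign]
  have hkσ : ∀ (x : lattice) i, ((k • x : lattice) : Coord → ℤ) i =
      sign (c i) * (x : Coord → ℤ) (σ i) := by
    intro x i
    rw [hc, ← hcoord, hτσ]
  have hkτ : ∀ (x : lattice) a, ((k⁻¹ • x : lattice) : Coord → ℤ) a =
      e a * (x : Coord → ℤ) (τ a) := by
    intro x a
    have h := hcoord (k⁻¹ • x) a
    rw [smul_inv_smul] at h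
    rw [h]
    rcases he a with h1 | h1 <;> rw [h1] <;> ring
  refine ⟨c, sign_mem_golay_of_signed_perm hkσ, σ, fun d => ⟨fun h => ?_, fun h => ?_⟩, hkσ⟩
  · have h1 := comp_mem_golay_of_signed_perm he hkτ h
    have h2 : (d ∘ σ) ∘ τ = d := by
      funext a
      simp only [Function.comp_apply, hστ]
    rwa [h2] at h1
  · exact comp_mem_golay_of_signed_perm (fun i => by rw [hc]; exact he _) hkσ h

/-! ### The dichotomy -/

theorem mem_fixedLattice {G : Subgroup Co0} {u : lattice} :
    u ∈ fixedLattice G ↔ ∀ g ∈ G, g • u = u :=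
  ⟨fun h g hg => h ⟨g, hg⟩, fun h g => h g.1 g.2⟩

theorem two_nsmul_injective {x y : lattice} (h : 2 • x = 2 • y) : x = y := by
  ext i
  have h1 := congrArg (fun z : lattice => (z : Coord → ℤ) i) h
  simp only [two_nsmul_apply] at h1
  omega

/-- An element of odd order cannot negate a nonzero vector. -/
theorem smul_eq_of_odd {g : Co0} (hg : Odd (orderOf g)) {v : lattice}
    (h : g • v = v ∨ g • v = -v) : g • v = v := by
  refine h.elim id fun hneg => ?_
  have hpow : ∀ n : ℕ, g ^ (2 * n) • v = v := by
    intro n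
    induction n with
    | zero => simp
    | succ n ih => rw [mul_add, pow_add, mul_smul, mul_one, pow_two, mul_smul, hneg, smul_neg, hneg,
        neg_neg, ih]
  obtain ⟨n, hn⟩ := hg
  have h1 : g ^ (2 * n + 1) • v = v := by rw [← hn, pow_orderOf_eq_one, one_smul]
  rwa [pow_succ', mul_smul, hpow] at h1

theorem isSLattice_of_forall_short {G : Subgroup Co0} (hG : G = O2 G)
    (h : ∀ u ∈ fixedLattice G, ∃ v w : lattice, u = v + 2 • w ∧ sqLen v ≤ 48) :
    IsSLattice (fixedLattice G) := by
  intro u hu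
  obtain ⟨v, w, huv, hv⟩ := h u hu
  rw [mem_fixedLattice] at hu
  have hpm : ∀ g ∈ G, g • v = v ∨ g • v = -v := by
    intro g hg
    have h1 : g • v = v + 2 • (w - g • w) := by
      have h2 := hu g hg
      rw [huv, two_nsmul, smul_add, smul_add] at h2
      rw [smul_sub, ← add_sub_assoc, eq_sub_iff_add_eq, two_nsmul, two_nsmul]
      exact h2
    rw [h1]
    exact eq_or_eq_neg_of_sqLen_le hv (by rw [← h1, sqLen_smul]; exact hv)
  have hfix : ∀ g ∈ G, g • v = v := by
    have hle : O2 G ≤ MulAction.stabilizer Co0 v :=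
      (Subgroup.closure_le _).2 fun g hg => smul_eq_of_odd hg.2 (hpm g hg.1)
    rw [← hG] at hle
    exact fun g hg => hle hg
  refine ⟨v, w, huv, ?_, mem_fixedLattice.2 fun g hg => two_nsmul_injective ?_⟩
  · rw [form_self, div_le_iff₀ (by norm_num)]
    exact_mod_cast hv
  · have h2 := hu g hg
    rw [huv, two_nsmul, smul_add, smul_add, hfix g hg] at h2
    rw [two_nsmul, two_nsmul]
    exact add_left_cancel h2

/-- An isometry that fixes a vector in the class of a frame permutes that frame up to signs. -/
theorem conj_mem_monomial {k g : Co0} {u w : lattice} (hk : k • u = frameVec none + 2 • w)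
    (hg : g • u = u) : k * g * k⁻¹ ∈ monomial := by
  refine mem_monomial_of_frame fun a => ?_
  obtain ⟨w', hw'⟩ := exists_frameVec_eq a none
  have hu : frameVec a = k • u + 2 • (w' - w) := by
    rw [hk, hw']
    abel
  have h1 : (k * g * k⁻¹) • k • u = k • u := by
    rw [← mul_smul, inv_mul_cancel_right, mul_smul, hg]
  refine eq_frameVec_of_congr (b := none) (w := w + (k * g * k⁻¹) • (w' - w)) ?_ ?_
  · rw [sqLen_smul, sqLen_frameVec]
  · rw [hu, smul_add, h1, two_nsmul (w' - w), smul_add, hk]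
    abel

end Leech

theorem proposition3p1 (G : Subgroup Leech.Co0) (hG : G = Leech.O2 G) :
    (∃ k : Leech.Co0, ∀ g ∈ Leech.tilde G, k * g * k⁻¹ ∈ Leech.monomial) ∨
      Leech.IsSLattice (Leech.fixedLattice G) := by
  by_cases h : ∀ u ∈ Leech.fixedLattice G, ∃ v w : Leech.lattice,
      u = v + 2 • w ∧ Leech.sqLen v ≤ 48
  · exact Or.inr (Leech.isSLattice_of_forall_short hG h)
  · push Not at h
    obtain ⟨u, hu, hlong⟩ := h
    left
    obtain ⟨k, v, w, hk, hv | hv⟩ := Leech.hasShortForm u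
    · refine absurd hv (not_le.2 ?_)
      rw [← Leech.sqLen_smul k⁻¹]
      refine hlong (k⁻¹ • v) (k⁻¹ • w) ?_
      rw [two_nsmul, ← smul_add, ← smul_add, ← two_nsmul, ← hk, inv_smul_smul]
    · have hv' : v = Leech.frameVec none := by
        ext i
        rw [hv, Leech.frameVec_apply]
      rw [hv'] at hk
      refine ⟨k, fun g hg => Leech.conj_mem_monomial hk ?_⟩
      exact (mem_fixingSubgroup_iff Leech.Co0).1 hg u hu
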